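/- Let $\Sigma$ be an alphabet (a finite non-empty set) and let $w\ge 1$ be an integer. A $(\Sigma,w)$-layer is a tuple $B=(\ell,r,T,I,F,\iota,\phi)$ with $\ell,r\subseteq\{0,\dots,w-1\}$ (left and right states), $T\subseteq \ell\times\Sigma\times r$, $I\subseteq\ell$, $F\subseteq r$ and $\iota,\phi\in\{0,1\}$, such that $\iota=0$ implies $I=\emptyset$ and $\phi=0$ implies $F=\emptyset$. The layer is deterministic if $\iota=1$ implies $I=\ell$ and $|\ell|=1$, and for all $p\in\ell$, $a\in\Sigma$ there is at most one $q$ with $(p,a,q)\in T$. It is complete if $\iota=1$ implies $I\neq\emptyset$, and for all $p\in\ell$, $a\in\Sigma$ there is at least one $q$ with $(p,a,q)\in T$. A $(\Sigma,w)$-ODD of length $k\ge 1$ is a string $D=B_1\cdots B_k$ of $(\Sigma,w)$-layers with $\ell(B_{i+1})=r(B_i)$ for $1\le i<k$, with $\iota(B_i)=1$ exactly for $i=1$, and with $\phi(B_i)=1$ exactly for $i=k$. It is deterministic (complete) if all of its layers are. Its language is the length-typed set $\mathcal L(D)=(k,L)$, where $L\subseteq\Sigma^k$ is the set of all strings $a_1\cdots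 a_k$ for which there are states $q_0,\dots,q_k$ with $q_0\in I(B_1)$, $q_k\in F(B_k)$ and $(q_{i-1},a_i,q_i)\in T(B_i)$ for $1\le i\le k$. A $(\Sigma,w)$-SOFA (second-order finite automaton) is a (nondeterministic) finite automaton $\mathcal F$ over the alphabet of all $(\Sigma,w)$-layers such that every string accepted by $\mathcal F$ is a $(\Sigma,w)$-ODD. Its second language is $\mathcal L_2(\mathcal F)=\{\mathcal L(D) : D \text{ is accepted by } \mathcal F\}$. Let $\mathcal D(\Sigma,w)$ be the set of all $\mathcal L(D)$ with $D$ a deterministic, complete $(\Sigma,w)$-ODD. Theorem. Let $\mathcal F,\mathcal F_1,\mathcal F_2$ be $(\Sigma,w)$-SOFAs. 1. There is a $(\Sigma,2^w)$-SOFA with second language $\mathcal L_2(\mathcal F_1)\cap\mathcal L_2(\mathcal F_2)$. 2. There is a $(\Sigma,2^w)$-SOFA with second language $\mathcal L_2(\mathcal F_1)\cup\mathcal L_2(\mathcal F_2)$. 3. There is a $(\Sigma,2^w)$-SOFA with second language $\mathcal L_2(\mathcal F_1)\setminus\mathcal L_2(\mathcal F_2)$. 4. There is a $(\Sigma,w)$-SOFA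 with second language $\mathcal D(\Sigma,w)$. 5. For every integer $w'\ge 1$ there is a $(\Sigma,2^{\max\{w,w'\}})$-SOFA with second language $\mathcal D(\Sigma,w')\setminus\mathcal L_2(\mathcal F)$. Moreover, for the alphabets $\Sigma=\{0,\dots,n-1\}$, $n\ge 1$, the automata in 1-5 can be computed: for each of the five items there is a computable function which, given $n$, $w$, (in item 5) $w'$, and explicit finite descriptions of the given SOFAs, outputs an explicit finite description of an automaton as claimed. Finally, the following problems are decidable, each by one algorithm that receives $n$, $w$ and explicit finite descriptions of $(\{0,\dots,n-1\},w)$-SOFAs $\mathcal F_1,\mathcal F_2$ as input: 6. whether $\mathcal L_2(\mathcal F_1)\cap\mathcal L_2(\mathcal F_2)=\emptyset$; 7. whether $\mathcal L_2(\mathcal F_1)\subseteq\mathcal L_2(\mathcal F_2)$. -/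

import Mathlib

namespace SOFA

/-- An `(A, w)`-layer. The states of a layer are elements of `Fin w = {0, …, w - 1}`. -/
@[ext]
structure Layer (A : Type*) (w : ℕ) where
  left : Finset (Fin w)
  right : Finset (Fin w)
  trans : Finset (Fin w × A × Fin w)
  init : Finset (Fin w)
  final : Finset (Fin w)
  initFlag : Bool
  finalFlag : Bool
  trans_mem : ∀ t ∈ trans, t.1 ∈ left ∧ t.2.2 ∈ right
  init_subset : init ⊆ left
  final_subset : final ⊆ right
  init_eq_empty : initFlag = false → init = ∅
  final_eq_empty : finalFlag = false → final = ∅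

section

variable {A : Type*} {w : ℕ}

/-- Deterministic layers. -/
def Layer.Deterministic (l : Layer A w) : Prop :=
  (l.initFlag = true → l.init = l.left ∧ l.left.card = 1) ∧
    ∀ p ∈ l.left, ∀ a : A, ∀ q ∈ l.right, ∀ q' ∈ l.right,
      (p, a, q) ∈ l.trans → (p, a, q') ∈ l.trans → q = q'

/-- Complete layers. -/
def Layer.Complete (l : Layer A w) : Prop :=
  (l.initFlag = true → l.init.Nonempty) ∧
    ∀ p ∈ l.left, ∀ a : A, ∃ q ∈ l.right, (p, a, q) ∈ l.trans

/-- A non-empty string of layers is an ordered decision diagram if consecutive frontiers agree,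
exactly the first layer carries the initial flag, and exactly the last one the final flag. -/
def IsODD (D : List (Layer A w)) : Prop :=
  D ≠ [] ∧
  D.IsChain (fun l l' => l'.left = l.right) ∧
  (∀ l ∈ D.head?, l.initFlag = true) ∧ (∀ l ∈ D.tail, l.initFlag = false) ∧
  (∀ l ∈ D.getLast?, l.finalFlag = true) ∧ (∀ l ∈ D.dropLast, l.finalFlag = false)

/-- `t` is an accepting sequence of transitions for the string `s` in `D`: the labels of `t` spell
`s`, consecutive transitions fit together, the `i`-th transition lies in the `i`-th layer, the
first state is initial and the last state is final. -/
def IsAcceptingSeq (D : List (Layer A w)) (s : List A) (t : List (Fin w × A × Fin w)) : Prop :=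
  t.map (fun x => x.2.1) = s ∧
  t.IsChain (fun x y => y.1 = x.2.2) ∧
  List.Forall₂ (fun x l => x ∈ l.trans) t D ∧
  (∀ x ∈ t.head?, ∀ l ∈ D.head?, x.1 ∈ l.init) ∧
  (∀ x ∈ t.getLast?, ∀ l ∈ D.getLast?, x.2.2 ∈ l.final)

/-- The length-typed language `(k, L)` of an ordered decision diagram of length `k`. Every accepted
string has length `k`, so `L ⊆ A ^ k`. -/
def oddLang (D : List (Layer A w)) : ℕ × Set (List A) :=
  (D.length, {s | ∃ t, IsAcceptingSeq D s t})

/-- A finite automaton over the alphabet of `(A, w)`-layers is an `(A, w)`-second-order finite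
automaton if all strings that it accepts are ordered decision diagrams. (Finiteness of the set of
states is required where this is used.) -/
def IsSOFA {σ : Type*} (F : NFA (Layer A w) σ) : Prop :=
  ∀ D ∈ F.accepts, IsODD D

/-- The second language of an automaton over the alphabet of layers. -/
def secondLang {σ : Type*} (F : NFA (Layer A w) σ) : Set (ℕ × Set (List A)) :=
  {X | ∃ D ∈ F.accepts, oddLang D = X}

end

/-- The class of all languages of deterministic, complete `(A, w)`-ordered decision diagrams. -/
def detLangs (A : Type*) (w : ℕ) : Set (ℕ × Set (List A)) :=
  {X | ∃ D : List (Layer A w), IsODD D ∧ (∀ l ∈ D, l.Deterministic ∧ l.Complete) ∧ oddLang D = X}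

/-- The width-`w` complement of a class of length-typed languages. -/
def widthCompl {A : Type*} (w : ℕ) (X : Set (ℕ × Set (List A))) : Set (ℕ × Set (List A)) :=
  detLangs A w \ X

/-! ### Finite descriptions, as inputs and outputs of algorithms -/

/-- Codes of layers: lists of left states, right states, transitions, initial states and final
states, and the two flags. -/
abbrev LayerCode : Type :=
  List ℕ × List ℕ × List (ℕ × ℕ × ℕ) × List ℕ × List ℕ × Bool × Bool

/-- Codes of automata over layers: the number `m` of states (the states are `0, …, m - 1`), and
lists of initial states, final states and transitions. -/
abbrev AutCode : Type :=
  ℕ × List ℕ × List ℕ × List (ℕ × LayerCode × ℕ)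

/-- The list `L` enumerates, through the injection `v`, exactly the elements of `S`. -/
def Enumerates {α β : Type*} (v : α → β) (L : List β) (S : Finset α) : Prop :=
  ∀ x, x ∈ L ↔ ∃ y ∈ S, v y = x

/-- `c` is a code of the layer `l` over the alphabet `Fin n`. -/
def LayerCode.Describes {n w : ℕ} (c : LayerCode) (l : Layer (Fin n) w) : Prop :=
  Enumerates Fin.val c.1 l.left ∧
  Enumerates Fin.val c.2.1 l.right ∧
  Enumerates (fun t : Fin w × Fin n × Fin w => ((t.1 : ℕ), (t.2.1 : ℕ), (t.2.2 : ℕ)))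
    c.2.2.1 l.trans ∧
  Enumerates Fin.val c.2.2.2.1 l.init ∧
  Enumerates Fin.val c.2.2.2.2.1 l.final ∧
  c.2.2.2.2.2.1 = l.initFlag ∧
  c.2.2.2.2.2.2 = l.finalFlag

/-- The finite automaton over the alphabet of `(Fin n, w)`-layers that is described by a code.
List entries that are out of range are ignored. -/
def AutCode.toNFA (n w : ℕ) (c : AutCode) : NFA (Layer (Fin n) w) (Fin c.1) where
  step q l := {q' | ∃ d : LayerCode, d.Describes l ∧ ((q : ℕ), d, (q' : ℕ)) ∈ c.2.2.2}
  start := {q | (q : ℕ) ∈ c.2.1}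
  accept := {q | (q : ℕ) ∈ c.2.2.1}

/-- The automaton with code `c` is a `(Fin n, w)`-second-order finite automaton. -/
def AutCode.IsSOFA (n w : ℕ) (c : AutCode) : Prop :=
  SOFA.IsSOFA (c.toNFA n w)

/-- The second language of the automaton with code `c`. -/
def AutCode.secondLang (n w : ℕ) (c : AutCode) : Set (ℕ × Set (List (Fin n))) :=
  SOFA.secondLang (c.toNFA n w)


/-- Every finite set is enumerated by some list. -/
theorem exists_enumerates {α β : Type*} (v : α → β) (S : Finset α) :
    ∃ L : List β, Enumerates v L S :=
  ⟨S.toList.map v, fun x => by simp [List.mem_map]⟩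

/-- Every layer over the alphabet `Fin n` has a code. -/
theorem exists_describes {n w : ℕ} (l : Layer (Fin n) w) :
    ∃ c : LayerCode, c.Describes l := by
  obtain ⟨a, ha⟩ := exists_enumerates Fin.val l.left
  obtain ⟨b, hb⟩ := exists_enumerates Fin.val l.right
  obtain ⟨t, ht⟩ := exists_enumerates
    (fun t : Fin w × Fin n × Fin w => ((t.1 : ℕ), (t.2.1 : ℕ), (t.2.2 : ℕ))) l.trans
  obtain ⟨i, hi⟩ := exists_enumerates Fin.val l.init
  obtain ⟨f, hf⟩ := exists_enumerates Fin.val l.final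
  exact ⟨(a, b, t, i, f, l.initFlag, l.finalFlag), ha, hb, ht, hi, hf, rfl, rfl⟩

/-- A code describes at most one layer. -/
theorem describes_unique {n w : ℕ} {c : LayerCode} {l l' : Layer (Fin n) w}
    (h : c.Describes l) (h' : c.Describes l') : l = l' := by
  have key : ∀ {α β : Type} {v : α → β} (_ : Function.Injective v) {L : List β} {S T : Finset α},
      Enumerates v L S → Enumerates v L T → S = T := by
    intro α β v hv L S T hS hT
    ext y
    have h1 := hS (v y)
    have h2 := hT (v y)
    simp only [hv.eq_iff, exists_eq_right] at h1 h2
    exact h1.symm.trans h2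
  have ht : Function.Injective
      (fun t : Fin w × Fin n × Fin w => ((t.1 : ℕ), (t.2.1 : ℕ), (t.2.2 : ℕ))) := by
    rintro ⟨a, b, c⟩ ⟨a', b', c'⟩ h
    simpa [Fin.ext_iff] using h
  obtain ⟨h1, h2, h3, h4, h5, h6, h7⟩ := h
  obtain ⟨g1, g2, g3, g4, g5, g6, g7⟩ := h'
  exact Layer.ext (key Fin.val_injective h1 g1) (key Fin.val_injective h2 g2) (key ht h3 g3)
    (key Fin.val_injective h4 g4) (key Fin.val_injective h5 g5) (h6.symm.trans g6)
    (h7.symm.trans g7)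

/-- Every finite automaton over the alphabet of `(Fin n, w)`-layers with states `0, …, m - 1` is
described by a code. -/
theorem exists_code {n w m : ℕ} (F : NFA (Layer (Fin n) w) (Fin m)) :
    ∃ S T R, AutCode.toNFA n w (m, S, T, R) = F := by
  classical
  have hfin : Finite (Layer (Fin n) w) := by
    refine Finite.of_injective (β := Finset (Fin w) × Finset (Fin w) ×
      Finset (Fin w × Fin n × Fin w) × Finset (Fin w) × Finset (Fin w) × Bool × Bool)
      (fun l => (l.left, l.right, l.trans, l.init, l.final, l.initFlag, l.finalFlag)) ?_
    intro l l' h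
    simp only [Prod.mk.injEq] at h
    exact Layer.ext h.1 h.2.1 h.2.2.1 h.2.2.2.1 h.2.2.2.2.1 h.2.2.2.2.2.1 h.2.2.2.2.2.2
  choose c hc using fun l : Layer (Fin n) w => exists_describes l
  have hR : {x : Fin m × Layer (Fin n) w × Fin m | x.2.2 ∈ F.step x.1 x.2.1}.Finite :=
    Set.toFinite _
  refine ⟨((Set.toFinite F.start).toFinset.toList.map Fin.val),
    ((Set.toFinite F.accept).toFinset.toList.map Fin.val),
    (hR.toFinset.toList.map fun x => ((x.1 : ℕ), c x.2.1, (x.2.2 : ℕ))), ?_⟩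
  obtain ⟨step, start, accept⟩ := F
  simp only [AutCode.toNFA, NFA.mk.injEq]
  refine ⟨?_, ?_, ?_⟩
  · funext q l
    ext q'
    simp only [Set.mem_ofPred_eq, List.mem_map, Finset.mem_toList, Set.Finite.mem_toFinset,
      Prod.mk.injEq]
    constructor
    · rintro ⟨d, hd, ⟨p, a, p'⟩, hp, h1, h2, h3⟩
      obtain rfl : p = q := Fin.ext h1
      obtain rfl : p' = q' := Fin.ext h3
      subst h2
      obtain rfl := describes_unique hd (hc a)
      exact hp
    · intro h
      exact ⟨c l, hc l, (q, l, q'), h, rfl, rfl, rfl⟩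
  · ext q
    simp [Fin.val_inj]
  · ext q
    simp [Fin.val_inj]

end SOFA

/-!
Strings of layers of widths `w` and `W` that have the same length-typed language form a regular
set of pairs: an accepting run can be checked letter by letter, projecting runs away shows that a
string of layers labelled by an accepted string is recognised by a finite automaton, and equality of
languages is the complement of a projection of a symmetric difference of two such sets. Hence, for
every width `W`, the preimage under `oddLang` of a second language is regular. Boolean operations on
second languages become Boolean operations on these preimages, and intersecting the result with the
regular set of ordered decision diagrams gives a second-order automaton for it, provided that all
languages involved have diagrams of width `W`; renaming states provides these as soon as `w ≤ W`.

The tests for membership in all these sets are primitive recursive, and so are the bounds on their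
state complexity. Since a nonempty regular language has a word shorter than its state complexity,
emptiness and therefore equality are decidable, and an automaton for a given set is found by
exhaustive search.
-/

namespace SOFA

/-! ### State complexity -/

section StateComplexity

variable {α β τ : Type*} {L L₁ L₂ : Set (List α)} {N N₁ N₂ : ℕ}

/-- `L` is the language of a complete deterministic finite automaton with at most `N` states. -/
def StateComplexityLE (L : Set (List α)) (N : ℕ) : Prop :=
  ∃ k ≤ N, ∃ M : DFA α (Fin k), M.accepts = L

theorem StateComplexityLE.of_dfa {σ : Type*} [Finite σ] (M : DFA α σ) :
    StateComplexityLE M.accepts (Nat.card σ) :=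
  ⟨_, le_rfl, DFA.reindex (Finite.equivFin σ) M, DFA.accepts_reindex _ _⟩

theorem StateComplexityLE.of_nfa {σ : Type*} [Finite σ] (M : NFA α σ) :
    StateComplexityLE M.accepts (2 ^ Nat.card σ) := by
  have := Fintype.ofFinite σ
  have h := StateComplexityLE.of_dfa M.toDFA
  rwa [NFA.toDFA_correct, Nat.card_eq_fintype_card, Fintype.card_set,
    ← Nat.card_eq_fintype_card] at h

theorem StateComplexityLE.exists_nfa (h : StateComplexityLE L N) :
    ∃ (m : ℕ) (M : NFA α (Fin m)), M.accepts = L := by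
  obtain ⟨k, -, M, rfl⟩ := h
  exact ⟨k, M.toNFA, M.toNFA_correct⟩

theorem StateComplexityLE.compl (h : StateComplexityLE L N) : StateComplexityLE Lᶜ N := by
  obtain ⟨k, hk, M, rfl⟩ := h
  exact ⟨k, hk, Mᶜ, M.accepts_compl⟩

theorem StateComplexityLE.inter (h₁ : StateComplexityLE L₁ N₁) (h₂ : StateComplexityLE L₂ N₂) :
    StateComplexityLE (L₁ ∩ L₂) (N₁ * N₂) := by
  obtain ⟨k₁, hk₁, M₁, rfl⟩ := h₁
  obtain ⟨k₂, hk₂, M₂, rfl⟩ := h₂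
  obtain ⟨k, hk, M, hM⟩ := StateComplexityLE.of_dfa (M₁.inter M₂)
  rw [Nat.card_prod, Nat.card_fin, Nat.card_fin] at hk
  exact ⟨k, hk.trans (Nat.mul_le_mul hk₁ hk₂), M, hM.trans (DFA.accepts_inter M₁ M₂)⟩

theorem StateComplexityLE.diff (h₁ : StateComplexityLE L₁ N₁) (h₂ : StateComplexityLE L₂ N₂) :
    StateComplexityLE (L₁ \ L₂) (N₁ * N₂) :=
  h₁.inter h₂.compl

theorem StateComplexityLE.union (h₁ : StateComplexityLE L₁ N₁) (h₂ : StateComplexityLE L₂ N₂) :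
    StateComplexityLE (L₁ ∪ L₂) (N₁ * N₂) := by
  simpa only [Set.compl_inter, compl_compl] using (h₁.compl.inter h₂.compl).compl

theorem StateComplexityLE.symmDiff (h₁ : StateComplexityLE L₁ N₁) (h₂ : StateComplexityLE L₂ N₂) :
    StateComplexityLE (symmDiff L₁ L₂) (N₁ * N₂ * (N₂ * N₁)) :=
  (h₁.diff h₂).union (h₂.diff h₁)

theorem StateComplexityLE.comap (h : StateComplexityLE L N) (f : β → α) :
    StateComplexityLE (List.map f ⁻¹' L) N := by
  obtain ⟨k, hk, M, rfl⟩ := h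
  exact ⟨k, hk, M.comap f, M.accepts_comap f⟩

/-- The image of an automaton under a letter-to-letter map, which guesses preimages of letters. -/
def mapNFA {σ : Type*} (f : α → β) (M : DFA α σ) : NFA β σ where
  step q b := {q' | ∃ a, f a = b ∧ M.step q a = q'}
  start := {M.start}
  accept := M.accept

theorem mem_mapNFA_evalFrom {σ : Type*} (f : α → β) (M : DFA α σ) (q q' : σ) (y : List β) :
    q' ∈ (mapNFA f M).evalFrom {q} y ↔ ∃ x, x.map f = y ∧ M.evalFrom q x = q' := by
  induction y generalizing q with
  | nil => simp [eq_comm]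
  | cons b y ih =>
    rw [NFA.evalFrom_cons, NFA.mem_evalFrom_iff_exists]
    simp only [NFA.stepSet_singleton, ih]
    constructor
    · rintro ⟨_, ⟨a, rfl, rfl⟩, x, rfl, rfl⟩
      exact ⟨a :: x, rfl, rfl⟩
    · rintro ⟨_ | ⟨a, x⟩, hxy, rfl⟩
      · simp at hxy
      · obtain ⟨rfl, rfl⟩ := List.cons_eq_cons.mp hxy
        exact ⟨_, ⟨a, rfl, rfl⟩, x, rfl, rfl⟩

theorem StateComplexityLE.map (h : StateComplexityLE L N) (f : α → β) :
    StateComplexityLE (List.map f '' L) (2 ^ N) := by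
  obtain ⟨k, hk, M, rfl⟩ := h
  obtain ⟨j, hj, M', hM'⟩ := StateComplexityLE.of_nfa (mapNFA f M)
  refine ⟨j, hj.trans ?_, M', hM'.trans ?_⟩
  · simpa using Nat.pow_le_pow_right two_pos hk
  · ext y
    change (∃ q ∈ M.accept, q ∈ (mapNFA f M).evalFrom {M.start} y) ↔ _
    simp only [mem_mapNFA_evalFrom]
    constructor
    · rintro ⟨_, hq, x, rfl, rfl⟩
      exact ⟨x, hq, rfl⟩
    · rintro ⟨x, hx, rfl⟩
      exact ⟨_, hx, x, rfl, rfl⟩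

theorem StateComplexityLE.exists_length_lt (h : StateComplexityLE L N) (hL : L.Nonempty) :
    ∃ x ∈ L, x.length < N := by
  classical
  obtain ⟨k, hk, M, rfl⟩ := h
  obtain ⟨x, hx, hmin⟩ := exists_minimalFor_of_wellFoundedLT (· ∈ M.accepts) List.length hL
  refine ⟨x, hx, lt_of_not_ge fun hlong => ?_⟩
  obtain ⟨q, a, b, c, rfl, -, hb, ha, -, hc⟩ :=
    M.evalFrom_split (x := x) (s := M.start) (by simpa using hk.trans hlong) rfl
  have hac : a ++ c ∈ M.accepts := by
    change M.evalFrom M.start (a ++ c) ∈ M.accept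
    rw [DFA.evalFrom_of_append, ha, hc]
    exact hx
  have hle := hmin hac (by simp only [List.length_append]; omega)
  have hpos := List.length_pos_iff.mpr hb
  simp only [List.length_append] at hle
  omega

/-- The strings over `β` that are determined by conditions on their letters, on their first letter,
on neighbouring letters `x`, `y`, and on their last letter, where the last two depend on `x` and on
the last letter only through the observation `obs`. -/
def localLang (obs : β → τ) (good first : β → Prop) (next : τ → β → Prop)
    (last : Option τ → Prop) : Set (List β) :=
  {z | (∀ x ∈ z, good x) ∧ (∀ x ∈ z.head?, first x) ∧ z.IsChain (fun x y => next (obs x) y) ∧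
    last (z.getLast?.map obs)}

/-- The automaton for `localLang`: it remembers whether a condition has failed and what was observed
at the last letter. -/
def localDFA (obs : β → τ) (good first : β → Prop) (next : τ → β → Prop)
    (last : Option τ → Prop) : DFA β (Prop × Option τ) where
  step s x := (s.1 ∧ good x ∧ s.2.elim (first x) (next · x), some (obs x))
  start := (True, none)
  accept := {s | s.1 ∧ last s.2}

theorem localDFA_eval (obs : β → τ) (good first : β → Prop) (next : τ → β → Prop)
    (last : Option τ → Prop) (z : List β) :
    (localDFA obs good first next last).eval z =
      ((∀ x ∈ z, good x) ∧ (∀ x ∈ z.head?, first x) ∧ z.IsChain (fun x y => next (obs x) y),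
        z.getLast?.map obs) := by
  induction z using List.reverseRecOn with
  | nil => simp [localDFA]
  | append_singleton z x ih =>
    rw [DFA.eval_append_singleton, ih]
    rcases z.eq_nil_or_concat with rfl | ⟨z, y, rfl⟩
    · simp [localDFA]
    · simp only [localDFA, List.concat_eq_append, List.mem_append, List.mem_cons,
        List.not_mem_nil, or_false, List.head?_append, List.head?_cons, Option.or_some,
        Option.mem_def, Option.some.injEq, forall_eq', List.isChain_append, List.IsChain.singleton,
        true_and, List.getLast?_append, List.getLast?_singleton, Option.some_or, Option.map_some,
        Option.elim_some, Prod.mk.injEq, eq_iff_iff]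
      grind

theorem localDFA_accepts (obs : β → τ) (good first : β → Prop) (next : τ → β → Prop)
    (last : Option τ → Prop) :
    (localDFA obs good first next last).accepts = localLang obs good first next last := by
  ext z
  rw [DFA.mem_accepts, localDFA_eval]
  exact and_assoc.trans (and_congr_right fun _ => and_assoc)

theorem stateComplexityLE_localLang [Finite τ] (obs : β → τ) (good first : β → Prop)
    (next : τ → β → Prop) (last : Option τ → Prop) :
    StateComplexityLE (localLang obs good first next last) (2 * (Nat.card τ + 1)) := by
  rw [← localDFA_accepts, ← Finite.card_option, ← Fintype.card_prop, ← Nat.card_eq_fintype_card,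
    ← Nat.card_prod]
  exact .of_dfa _

end StateComplexity

/-! ### The relation of having the same language -/

section Diagrams

variable {A : Type*} {w W : ℕ}

theorem isChain_and_iff {α : Type*} {R : α → α → Prop} {P Q : α → Prop} {z : List α} :
    z.IsChain (fun x y => R x y ∧ P x ∧ Q y) ↔
      z.IsChain R ∧ (∀ x ∈ z.dropLast, P x) ∧ ∀ y ∈ z.tail, Q y := by
  induction z using List.twoStepInduction with
  | nil => simp
  | singleton x => simp
  | cons_cons x y z _ ih =>
    specialize ih y
    grind

theorem isODD_iff {D : List (Layer A w)} :
    IsODD D ↔ D ≠ [] ∧ (∀ l ∈ D.head?, l.initFlag = true) ∧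
      D.IsChain (fun l l' => l'.left = l.right ∧ l.finalFlag = false ∧ l'.initFlag = false) ∧
      ∀ l ∈ D.getLast?, l.finalFlag = true := by
  have hchain := isChain_and_iff (z := D) (R := fun l l' => l'.left = l.right)
    (P := fun l => l.finalFlag = false) (Q := fun l => l.initFlag = false)
  rw [hchain, IsODD]
  tauto

theorem stateComplexityLE_isODD (P : Layer A w → Prop) :
    StateComplexityLE {D : List (Layer A w) | IsODD D ∧ ∀ l ∈ D, P l} (2 * (2 ^ w * 2 + 1)) := by
  have h := stateComplexityLE_localLang
    (obs := fun l : Layer A w => (l.right, l.finalFlag)) (good := P)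
    (first := fun l => l.initFlag = true)
    (next := fun s l' => l'.left = s.1 ∧ s.2 = false ∧ l'.initFlag = false)
    (last := fun o => ∃ R, o = some (R, true))
  rw [Nat.card_prod, Nat.card_eq_fintype_card (α := Bool), Fintype.card_bool,
    Nat.card_eq_fintype_card, Fintype.card_finset, Fintype.card_fin] at h
  convert h using 1
  ext D
  simp only [isODD_iff, localLang]
  rcases D.eq_nil_or_concat with rfl | ⟨D, l, rfl⟩
  · simp
  · simp only [ne_eq, Option.mem_def, List.concat_eq_append, Set.mem_ofPred_eq,
      List.append_eq_nil_iff, List.cons_ne_self, and_false, not_false_eq_true, List.head?_append,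
      List.head?_cons, Option.or_some, Option.some.injEq, forall_eq', List.getLast?_append,
      List.getLast?_singleton, Option.some_or, true_and, List.mem_append, List.mem_cons,
      List.not_mem_nil, or_false, Option.map_eq_some_iff, Prod.mk.injEq, ↓existsAndEq,
      exists_eq_left']
    tauto

/-- The strings of layers with chosen transitions in which the transitions form an accepting
sequence. -/
def acceptingRuns (A : Type*) (w : ℕ) : Set (List (Layer A w × (Fin w × A × Fin w))) :=
  {z | IsAcceptingSeq (z.map Prod.fst) (z.map fun x => x.2.2.1) (z.map Prod.snd)}

theorem mem_acceptingRuns {z : List (Layer A w × (Fin w × A × Fin w))} :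
    z ∈ acceptingRuns A w ↔
      (∀ x ∈ z, x.2 ∈ x.1.trans) ∧ (∀ x ∈ z.head?, x.2.1 ∈ x.1.init) ∧
        z.IsChain (fun x y => y.2.1 = x.2.2.2) ∧ ∀ x ∈ z.getLast?, x.2.2.2 ∈ x.1.final := by
  change IsAcceptingSeq _ _ _ ↔ _
  rw [IsAcceptingSeq, List.forall₂_map_left_iff, List.forall₂_map_right_iff, List.forall₂_same,
    List.isChain_map]
  simp only [List.map_map, List.head?_map, List.getLast?_map, Function.comp_def, true_and]
  cases z.head? <;> cases z.getLast? <;>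
    simp only [Option.map_none, Option.map_some, Option.mem_def, Option.some.injEq, forall_eq',
      reduceCtorEq, IsEmpty.forall_iff, implies_true, true_and, and_true] <;>
    tauto

theorem stateComplexityLE_acceptingRuns :
    StateComplexityLE (acceptingRuns A w) (2 * (w * 2 + 1)) := by
  have h := stateComplexityLE_localLang
    (obs := fun x : Layer A w × (Fin w × A × Fin w) => (x.2.2.2, x.2.2.2 ∈ x.1.final))
    (good := fun x => x.2 ∈ x.1.trans) (first := fun x => x.2.1 ∈ x.1.init)
    (next := fun s y => y.2.1 = s.1) (last := fun o => ∀ s ∈ o, s.2)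
  rw [Nat.card_prod, Nat.card_eq_fintype_card (α := Prop), Fintype.card_prop, Nat.card_fin] at h
  convert h using 1
  ext z
  rw [mem_acceptingRuns]
  simp only [localLang, Set.mem_ofPred_eq, Option.forall_mem_map]

/-- The strings of layers labelled by the letters of a string that these layers accept. -/
def acceptedPairs (A : Type*) (w : ℕ) : Set (List (Layer A w × A)) :=
  {y | y.map Prod.snd ∈ (oddLang (y.map Prod.fst)).2}

theorem exists_map_fst_snd_eq {α β : Type*} {x : List α} {y : List β} (h : x.length = y.length) :
    ∃ z : List (α × β), z.map Prod.fst = x ∧ z.map Prod.snd = y :=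
  ⟨x.zip y, List.map_fst_zip h.le, List.map_snd_zip h.ge⟩

theorem acceptedPairs_eq :
    acceptedPairs A w = List.map (fun x => (x.1, x.2.2.1)) '' acceptingRuns A w := by
  ext y
  constructor
  · rintro ⟨t, ht⟩
    obtain ⟨z, hfst, rfl⟩ := exists_map_fst_snd_eq ht.2.2.1.length_eq.symm
    have hlabel : z.map (fun x => x.2.2.1) = y.map Prod.snd := by rw [← ht.1, List.map_map]; rfl
    refine ⟨z, by rwa [acceptingRuns, Set.mem_ofPred_eq, hfst, hlabel], ?_⟩
    rw [← List.zip_unzip (z.map _), ← List.zip_unzip y]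
    simp [Function.comp_def, hfst, hlabel]
  · rintro ⟨z, hz, rfl⟩
    exact ⟨z.map Prod.snd, by simpa [acceptingRuns, Function.comp_def] using hz⟩

/-- The bound for the state complexity of `acceptedPairs A w` that comes from determinising the
projection of `acceptingRuns A w`. -/
def acceptedPairsBound (w : ℕ) : ℕ :=
  2 ^ (2 * (w * 2 + 1))

theorem stateComplexityLE_acceptedPairs :
    StateComplexityLE (acceptedPairs A w) (acceptedPairsBound w) :=
  acceptedPairs_eq ▸ stateComplexityLE_acceptingRuns.map _

theorem length_eq_of_mem_oddLang {D : List (Layer A w)} {s : List A} (hs : s ∈ (oddLang D).2) :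
    s.length = D.length := by
  obtain ⟨t, rfl, -, ht, -⟩ := hs
  rw [List.length_map, ht.length_eq]

theorem oddLang_eq_iff {D : List (Layer A w)} {D' : List (Layer A W)} :
    oddLang D = oddLang D' ↔ D.length = D'.length ∧
      ∀ s : List A, s.length = D.length → (s ∈ (oddLang D).2 ↔ s ∈ (oddLang D').2) := by
  constructor
  · intro h
    exact ⟨congrArg Prod.fst h, fun s _ => by rw [h]⟩
  · rintro ⟨hlen, h⟩
    refine Prod.ext hlen (Set.ext fun s => ⟨fun hs => ?_, fun hs => ?_⟩)
    · exact (h s (length_eq_of_mem_oddLang hs)).mp hs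
    · exact (h s ((length_eq_of_mem_oddLang hs).trans hlen.symm)).mpr hs

/-- The pairs of strings of layers of equal length that accept the same strings. -/
def sameLangPairs (A : Type*) (w W : ℕ) : Set (List (Layer A w × Layer A W)) :=
  {y | oddLang (y.map Prod.fst) = oddLang (y.map Prod.snd)}

theorem sameLangPairs_eq :
    sameLangPairs A w W = (List.map Prod.fst '' symmDiff
      (List.map (fun x : (Layer A w × Layer A W) × A => (x.1.1, x.2)) ⁻¹' acceptedPairs A w)
      (List.map (fun x : (Layer A w × Layer A W) × A => (x.1.2, x.2)) ⁻¹' acceptedPairs A W))ᶜ := by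
  ext y
  have hmem (z : List ((Layer A w × Layer A W) × A)) :
      z ∈ symmDiff (List.map (fun x => (x.1.1, x.2)) ⁻¹' acceptedPairs A w)
          (List.map (fun x => (x.1.2, x.2)) ⁻¹' acceptedPairs A W) ↔
        ¬ (z.map Prod.snd ∈ (oddLang ((z.map Prod.fst).map Prod.fst)).2 ↔
          z.map Prod.snd ∈ (oddLang ((z.map Prod.fst).map Prod.snd)).2) := by
    simp only [acceptedPairs, Set.mem_symmDiff, Set.mem_preimage, Set.mem_ofPred_eq, List.map_map,
      Function.comp_def]
    tauto
  constructor
  · rintro (hy : oddLang _ = oddLang _) ⟨z, hz, rfl⟩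
    exact (hmem z).mp hz (by rw [hy])
  · intro hy
    refine oddLang_eq_iff.mpr ⟨by simp only [List.length_map], fun s hs => ?_⟩
    obtain ⟨z, rfl, rfl⟩ := exists_map_fst_snd_eq (hs.trans (List.length_map _)).symm
    exact not_not.mp fun h => hy ⟨z, (hmem z).mpr h, rfl⟩

/-- The bound for the state complexity of `sameLangPairs A w W` that comes from determinising the
projection of a symmetric difference. -/
def sameLangPairsBound (w W : ℕ) : ℕ :=
  2 ^ (acceptedPairsBound w * acceptedPairsBound W *
    (acceptedPairsBound W * acceptedPairsBound w))

theorem stateComplexityLE_sameLangPairs :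
    StateComplexityLE (sameLangPairs A w W) (sameLangPairsBound w W) := by
  rw [sameLangPairs_eq]
  exact ((stateComplexityLE_acceptedPairs.comap _).symmDiff
    (stateComplexityLE_acceptedPairs.comap _)).map _ |>.compl

theorem oddLang_preimage_image (K : Set (List (Layer A w))) :
    (oddLang ⁻¹' (oddLang '' K) : Set (List (Layer A W))) =
      List.map Prod.snd '' (List.map Prod.fst ⁻¹' K ∩ sameLangPairs A w W) := by
  ext D'
  constructor
  · rintro ⟨D, hD, h⟩
    obtain ⟨y, rfl, rfl⟩ := exists_map_fst_snd_eq (congrArg Prod.fst h : D.length = D'.length)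
    exact ⟨y, ⟨hD, h⟩, rfl⟩
  · rintro ⟨y, ⟨hK, hy⟩, rfl⟩
    exact ⟨_, hK, hy⟩

theorem StateComplexityLE.oddLang_preimage_image {K : Set (List (Layer A w))} {N : ℕ}
    (h : StateComplexityLE K N) :
    StateComplexityLE (oddLang ⁻¹' (oddLang '' K) : Set (List (Layer A W)))
      (2 ^ (N * sameLangPairsBound w W)) :=
  SOFA.oddLang_preimage_image (W := W) K ▸ ((h.comap _).inter stateComplexityLE_sameLangPairs).map _

end Diagrams

/-! ### Widening -/

section Widening

variable {A : Type*} {w W : ℕ}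

/-- The action on transitions of a renaming of states. -/
@[simps]
def relabelTrans (A : Type*) (f : Fin w ↪ Fin W) : Fin w × A × Fin w ↪ Fin W × A × Fin W where
  toFun t := (f t.1, t.2.1, f t.2.2)
  inj' s t h := by
    simp only [Prod.mk.injEq, f.injective.eq_iff] at h
    exact Prod.ext h.1 (Prod.ext h.2.1 h.2.2)

/-- The layer obtained by renaming the states along an embedding, used to regard a layer as a layer
of larger width. -/
def Layer.relabel (f : Fin w ↪ Fin W) (l : Layer A w) : Layer A W where
  left := l.left.map f
  right := l.right.map f
  trans := l.trans.map (relabelTrans A f)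
  init := l.init.map f
  final := l.final.map f
  initFlag := l.initFlag
  finalFlag := l.finalFlag
  trans_mem := by
    simp only [Finset.mem_map, forall_exists_index, and_imp]
    rintro _ t ht rfl
    exact ⟨⟨_, (l.trans_mem t ht).1, rfl⟩, ⟨_, (l.trans_mem t ht).2, rfl⟩⟩
  init_subset := Finset.map_subset_map.mpr l.init_subset
  final_subset := Finset.map_subset_map.mpr l.final_subset
  init_eq_empty h := by rw [l.init_eq_empty h, Finset.map_empty]
  final_eq_empty h := by rw [l.final_eq_empty h, Finset.map_empty]

theorem IsODD.relabel (f : Fin w ↪ Fin W) {D : List (Layer A w)} (hD : IsODD D) :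
    IsODD (D.map (Layer.relabel f)) := by
  simpa [IsODD, List.isChain_map, Layer.relabel, ← List.map_tail, ← List.map_dropLast] using hD

theorem isAcceptingSeq_relabel (f : Fin w ↪ Fin W) {D : List (Layer A w)} {s : List A}
    {t : List (Fin w × A × Fin w)} :
    IsAcceptingSeq (D.map (Layer.relabel f)) s (t.map (relabelTrans A f)) ↔
      IsAcceptingSeq D s t := by
  simp only [IsAcceptingSeq, List.map_map, List.isChain_map, List.forall₂_map_left_iff,
    List.forall₂_map_right_iff, List.head?_map, List.getLast?_map, Option.forall_mem_map,
    Layer.relabel, Finset.mem_map']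
  simp only [relabelTrans_apply, Finset.mem_map', f.injective.eq_iff, Function.comp_def]

theorem exists_map_eq_of_forall₂ {α β γ : Type*} {f : γ → α} {R : α → β → Prop} {x : List α}
    {y : List β} (h : List.Forall₂ R x y) (hR : ∀ a b, R a b → ∃ c, f c = a) :
    ∃ z : List γ, z.map f = x := by
  induction h with
  | nil => exact ⟨[], rfl⟩
  | cons hab _ ih =>
    obtain ⟨c, rfl⟩ := hR _ _ hab
    obtain ⟨z, rfl⟩ := ih
    exact ⟨c :: z, rfl⟩

theorem oddLang_relabel (f : Fin w ↪ Fin W) (D : List (Layer A w)) :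
    oddLang (D.map (Layer.relabel f)) = oddLang D := by
  refine Prod.ext (List.length_map _) (Set.ext fun s => ⟨?_, ?_⟩)
  · rintro ⟨t', ht'⟩
    obtain ⟨t, rfl⟩ : ∃ t : List (Fin w × A × Fin w), t.map (relabelTrans A f) = t' := by
      refine exists_map_eq_of_forall₂ (List.forall₂_map_right_iff.mp ht'.2.2.1) fun x l hx => ?_
      obtain ⟨y, -, hy⟩ := Finset.mem_map.mp hx
      exact ⟨y, hy⟩
    exact ⟨t, (isAcceptingSeq_relabel f).mp ht'⟩
  · rintro ⟨t, ht⟩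
    exact ⟨_, (isAcceptingSeq_relabel f).mpr ht⟩

/-- The languages of the `(A, w)`-ordered decision diagrams. -/
def oddLangs (A : Type*) (w : ℕ) : Set (ℕ × Set (List A)) :=
  oddLang '' {D : List (Layer A w) | IsODD D}

theorem oddLangs_mono (h : w ≤ W) : oddLangs A w ⊆ oddLangs A W := by
  rintro _ ⟨D, hD, rfl⟩
  exact ⟨_, hD.relabel (Fin.castLEEmb h), oddLang_relabel _ D⟩

theorem secondLang_eq_image {σ : Type*} (F : NFA (Layer A w) σ) :
    secondLang F = oddLang '' F.accepts := rfl

theorem IsSOFA.secondLang_subset {σ : Type*} {F : NFA (Layer A w) σ} (hF : IsSOFA F) :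
    secondLang F ⊆ oddLangs A w :=
  Set.image_mono hF

/-- The deterministic, complete `(A, w)`-ordered decision diagrams. -/
def detODDs (A : Type*) (w : ℕ) : Set (List (Layer A w)) :=
  {D | IsODD D ∧ ∀ l ∈ D, l.Deterministic ∧ l.Complete}

theorem detLangs_eq_image : detLangs A w = oddLang '' detODDs A w := by
  simp only [detLangs, detODDs, Set.image, Set.mem_ofPred_eq, and_assoc]

theorem detLangs_subset : detLangs A w ⊆ oddLangs A w := by
  rw [detLangs_eq_image]
  exact Set.image_mono fun _ => And.left

theorem isSOFA_and_secondLang_eq {σ : Type*} {G : NFA (Layer A W) σ}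
    {X : Set (ℕ × Set (List A))} (hX : X ⊆ oddLangs A W)
    (hG : G.accepts = {D | IsODD D} ∩ oddLang ⁻¹' X) : IsSOFA G ∧ secondLang G = X := by
  rw [secondLang_eq_image, hG, Set.image_inter_preimage]
  refine ⟨fun D hD => ?_, Set.inter_eq_right.mpr hX⟩
  rw [hG] at hD
  exact hD.1

end Widening

/-! ### Primitive recursive functions on lists -/

section PrimitiveRecursion

attribute [fun_prop] Primrec
attribute [fun_prop] Primrec.id Primrec.const Primrec.comp Primrec.pair

variable {α β γ δ : Type*} [Primcodable α] [Primcodable β] [Primcodable γ] [Primcodable δ]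

@[fun_prop]
theorem primrec_fst {f : α → β × γ} (hf : Primrec f) : Primrec fun a => (f a).1 :=
  Primrec.fst.comp hf

@[fun_prop]
theorem primrec_snd {f : α → β × γ} (hf : Primrec f) : Primrec fun a => (f a).2 :=
  Primrec.snd.comp hf

@[fun_prop]
theorem primrec_and {f g : α → Bool} (hf : Primrec f) (hg : Primrec g) :
    Primrec fun a => f a && g a :=
  Primrec.and.comp hf hg

@[fun_prop]
theorem primrec_or {f g : α → Bool} (hf : Primrec f) (hg : Primrec g) :
    Primrec fun a => f a || g a :=
  Primrec.or.comp hf hg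

@[fun_prop]
theorem primrec_not {f : α → Bool} (hf : Primrec f) : Primrec fun a => !f a :=
  Primrec.not.comp hf

@[fun_prop]
theorem primrec_beq [BEq β] [LawfulBEq β] {f g : α → β} (hf : Primrec f) (hg : Primrec g) :
    Primrec fun a => f a == g a := by
  have : DecidableEq β := instDecidableEqOfLawfulBEq
  exact (Primrec.eq.decide.comp hf hg).of_eq fun a => by simp [beq_eq_decide]

@[fun_prop]
theorem primrec_succ {f : α → ℕ} (hf : Primrec f) : Primrec fun a => f a + 1 :=
  Primrec.succ.comp hf

@[fun_prop]
theorem primrec_mul {f g : α → ℕ} (hf : Primrec f) (hg : Primrec g) :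
    Primrec fun a => f a * g a :=
  Primrec.nat_mul.comp hf hg

@[fun_prop]
theorem primrec_pow {f g : α → ℕ} (hf : Primrec f) (hg : Primrec g) :
    Primrec fun a => f a ^ g a :=
  (Primrec₂.unpaired'.mp Nat.Primrec.pow : Primrec₂ fun m n : ℕ => m ^ n).comp hf hg

@[fun_prop]
theorem primrec_max {f g : α → ℕ} (hf : Primrec f) (hg : Primrec g) :
    Primrec fun a => max (f a) (g a) :=
  Primrec.nat_max.comp hf hg

@[fun_prop]
theorem primrec_option_all {f : α → Option β} {g : α → β → Bool} (hf : Primrec f)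
    (hg : Primrec fun x : α × β => g x.1 x.2) : Primrec fun a => (f a).all (g a) :=
  (Primrec.option_casesOn hf (Primrec.const true) hg).of_eq fun a => by cases f a <;> rfl

@[fun_prop]
theorem primrec_length {f : α → List β} (hf : Primrec f) : Primrec fun a => (f a).length :=
  Primrec.list_length.comp hf

@[fun_prop]
theorem primrec_isEmpty {f : α → List β} (hf : Primrec f) : Primrec fun a => (f a).isEmpty := by
  have h : Primrec fun a => (f a).length == 0 := by fun_prop
  exact h.of_eq fun a => by cases f a <;> rfl

@[fun_prop]
theorem primrec_range {f : α → ℕ} (hf : Primrec f) : Primrec fun a => List.range (f a) :=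
  Primrec.list_range.comp hf

@[fun_prop]
theorem primrec_getElem? {f : α → List β} {g : α → ℕ} (hf : Primrec f) (hg : Primrec g) :
    Primrec fun a => (f a)[g a]? :=
  Primrec.list_getElem?.comp hf hg

@[fun_prop]
theorem primrec_head? {f : α → List β} (hf : Primrec f) : Primrec fun a => (f a).head? :=
  Primrec.list_head?.comp hf

@[fun_prop]
theorem primrec_getLast? {f : α → List β} (hf : Primrec f) : Primrec fun a => (f a).getLast? :=
  (Primrec.list_head?.comp (Primrec.list_reverse.comp hf)).of_eq fun _ => List.head?_reverse

@[fun_prop]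
theorem primrec_cons {f : α → β} {g : α → List β} (hf : Primrec f) (hg : Primrec g) :
    Primrec fun a => f a :: g a :=
  Primrec.list_cons.comp hf hg

@[fun_prop]
theorem primrec_append {f g : α → List β} (hf : Primrec f) (hg : Primrec g) :
    Primrec fun a => f a ++ g a :=
  Primrec.list_append.comp hf hg

@[fun_prop]
theorem primrec_map {f : α → List β} {g : α → β → γ} (hf : Primrec f)
    (hg : Primrec fun x : α × β => g x.1 x.2) : Primrec fun a => (f a).map (g a) :=
  Primrec.list_map hf hg

@[fun_prop]
theorem primrec_flatMap {f : α → List β} {g : α → β → List γ} (hf : Primrec f)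
    (hg : Primrec fun x : α × β => g x.1 x.2) : Primrec fun a => (f a).flatMap (g a) :=
  Primrec.list_flatMap hf hg

@[fun_prop]
theorem primrec_filter {f : α → List β} {g : α → β → Bool} (hf : Primrec f)
    (hg : Primrec fun x : α × β => g x.1 x.2) : Primrec fun a => (f a).filter (g a) :=
  (Primrec.listFilterMap (g := fun a b => bif g a b then some b else none) hf
    (Primrec.cond hg (Primrec.option_some.comp Primrec.snd) (Primrec.const none))).of_eq fun a => by
      simp only [Bool.cond_eq_ite, ← List.filterMap_eq_filter, Option.guard]

@[fun_prop]
theorem primrec_foldl {f : α → List β} {g : α → δ} {h : α → δ → β → δ} (hf : Primrec f)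
    (hg : Primrec g) (hh : Primrec fun x : α × δ × β => h x.1 x.2.1 x.2.2) :
    Primrec fun a => (f a).foldl (h a) (g a) :=
  Primrec.list_foldl (h := fun a x => h a x.1 x.2) hf hg hh

@[fun_prop]
theorem primrec_foldr {f : α → List β} {g : α → δ} {h : α → β → δ → δ} (hf : Primrec f)
    (hg : Primrec g) (hh : Primrec fun x : α × β × δ => h x.1 x.2.1 x.2.2) :
    Primrec fun a => (f a).foldr (h a) (g a) :=
  Primrec.list_foldr (h := fun a x => h a x.1 x.2) hf hg hh

@[fun_prop]
theorem primrec_any {f : α → List β} {g : α → β → Bool} (hf : Primrec f)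
    (hg : Primrec fun x : α × β => g x.1 x.2) : Primrec fun a => (f a).any (g a) := by
  have h : Primrec fun a => (f a).foldr (fun b s => g a b || s) false := by fun_prop
  exact h.of_eq fun a => by induction f a <;> simp_all only [List.foldr, List.any]

@[fun_prop]
theorem primrec_all {f : α → List β} {g : α → β → Bool} (hf : Primrec f)
    (hg : Primrec fun x : α × β => g x.1 x.2) : Primrec fun a => (f a).all (g a) := by
  have h : Primrec fun a => !(f a).any fun b => !g a b := by fun_prop
  exact h.of_eq fun a => List.not_any_eq_all_not.trans (by simp only [Bool.not_not])

@[fun_prop]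
theorem primrec_contains [BEq β] [LawfulBEq β] {f : α → List β} {g : α → β} (hf : Primrec f)
    (hg : Primrec g) : Primrec fun a => (f a).contains (g a) := by
  have h : Primrec fun a => (f a).any fun b => g a == b := by fun_prop
  exact h.of_eq fun a => List.any_beq

@[fun_prop]
theorem primrec_product {f : α → List β} {g : α → List γ} (hf : Primrec f) (hg : Primrec g) :
    Primrec fun a => (f a).product (g a) := by
  unfold List.product
  fun_prop

@[fun_prop]
theorem primrec_sections {f : α → List (List β)} (hf : Primrec f) :
    Primrec fun a => (f a).sections := by
  have h : Primrec fun a =>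
      (f a).foldr (fun l S => S.flatMap fun s => l.map fun b => b :: s) [[]] := by fun_prop
  refine h.of_eq fun a => ?_
  induction f a with
  | nil => rfl
  | cons l L ih => rw [List.foldr_cons, ih, List.sections]

@[fun_prop]
theorem primrec_sublists' {f : α → List β} (hf : Primrec f) :
    Primrec fun a => (f a).sublists' := by
  have h : Primrec fun a =>
      (f a).foldr (fun b (S : List (List β)) => S ++ S.map fun s => b :: s) [[]] := by fun_prop
  refine h.of_eq fun a => ?_
  induction f a with
  | nil => rfl
  | cons b L ih => rw [List.foldr_cons, ih, List.sublists'_cons]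

end PrimitiveRecursion

section Enumerations

variable {α β : Type*} {v : α → β} {L L' : List β} {S S' : Finset α}

theorem Enumerates.forall_mem_iff (h : Enumerates v L S) {P : β → Prop} :
    (∀ x ∈ L, P x) ↔ ∀ y ∈ S, P (v y) := by
  simp only [h _, forall_exists_index, and_imp, forall_apply_eq_imp_iff₂]

theorem Enumerates.exists_mem_iff (h : Enumerates v L S) {P : β → Prop} :
    (∃ x ∈ L, P x) ↔ ∃ y ∈ S, P (v y) := by
  simp only [h _, exists_exists_and_eq_and]

theorem Enumerates.apply_mem_iff (h : Enumerates v L S) (hv : Function.Injective v) {y : α} :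
    v y ∈ L ↔ y ∈ S := by
  simp only [h _, hv.eq_iff, exists_eq_right]

theorem Enumerates.isEmpty_iff (h : Enumerates v L S) : L.isEmpty = true ↔ S = ∅ := by
  rw [List.isEmpty_iff, List.eq_nil_iff_forall_not_mem, h.forall_mem_iff,
    Finset.eq_empty_iff_forall_notMem]

theorem Enumerates.exists_of_mem_sublists' [Fintype α] {U : List β}
    (hU : Enumerates v U Finset.univ) (hL : L ∈ U.sublists') : ∃ S, Enumerates v L S := by
  refine ⟨(Set.toFinite {y | v y ∈ L}).toFinset, fun x => ⟨fun hx => ?_, ?_⟩⟩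
  · obtain ⟨y, -, rfl⟩ := (hU x).mp ((List.mem_sublists'.mp hL).subset hx)
    exact ⟨y, (Set.Finite.mem_toFinset _).mpr hx, rfl⟩
  · rintro ⟨y, hy, rfl⟩
    exact (Set.toFinite {y | v y ∈ L}).mem_toFinset.mp hy

theorem Enumerates.exists_mem_sublists' [Fintype α] {U : List β}
    (hU : Enumerates v U Finset.univ) (S : Finset α) : ∃ L ∈ U.sublists', Enumerates v L S := by
  classical
  refine ⟨U.filter fun x => ∃ y ∈ S, v y = x, List.mem_sublists'.mpr List.filter_sublist,
    fun x => ?_⟩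
  rw [List.mem_filter, decide_eq_true_iff, and_iff_right_iff_imp]
  rintro ⟨y, -, rfl⟩
  exact (hU _).mpr ⟨y, Finset.mem_univ y, rfl⟩

/-- The lists of length `k` with entries from `L`. -/
def words (L : List β) (k : ℕ) : List (List β) :=
  (List.replicate k L).sections

theorem mem_words {k : ℕ} {s : List β} : s ∈ words L k ↔ s.length = k ∧ ∀ x ∈ s, x ∈ L := by
  rw [words, List.mem_sections]
  induction k generalizing s with
  | zero => cases s <;> simp
  | succ k ih =>
    cases s with
    | nil => simp
    | cons x s =>
      simp only [List.replicate_succ, List.forall₂_cons, ih, List.length_cons,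
        Nat.add_right_cancel_iff, List.mem_cons, forall_eq_or_imp]
      tauto

@[fun_prop]
theorem primrec_words {γ : Type*} [Primcodable β] [Primcodable γ] {f : γ → List β} {g : γ → ℕ}
    (hf : Primrec f) (hg : Primrec g) : Primrec fun a => words (f a) (g a) := by
  have h : Primrec fun a => ((List.range (g a)).map fun _ => f a).sections := by fun_prop
  exact h.of_eq fun a => by rw [words, List.map_const', List.length_range]

/-- The test whether two lists have the same elements. -/
def sameElems [BEq β] (L L' : List β) : Bool :=
  (L.all fun x => L'.contains x) && L'.all fun x => L.contains x

variable [BEq β] [LawfulBEq β]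

theorem sameElems_iff : sameElems L L' = true ↔ ∀ x, x ∈ L ↔ x ∈ L' := by
  simp only [sameElems, Bool.and_eq_true, List.all_eq_true, List.contains_iff_mem, iff_def,
    forall_and]

theorem Enumerates.sameElems_iff (h : Enumerates v L' S) :
    sameElems L L' = true ↔ Enumerates v L S :=
  SOFA.sameElems_iff.trans (forall_congr' fun x => by rw [h x])

theorem Enumerates.contains_iff (h : Enumerates v L S) (hv : Function.Injective v) {y : α} :
    L.contains (v y) = true ↔ y ∈ S := by
  rw [List.contains_iff_mem, h.apply_mem_iff hv]

theorem Enumerates.sameElems_iff_eq (h : Enumerates v L S) (h' : Enumerates v L' S')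
    (hv : Function.Injective v) : sameElems L L' = true ↔ S = S' := by
  rw [h'.sameElems_iff]
  refine ⟨fun h'' => Finset.ext fun y => ?_, fun e => e ▸ h⟩
  rw [← h.apply_mem_iff hv, h''.apply_mem_iff hv]

@[fun_prop]
theorem primrec_sameElems {γ : Type*} [Primcodable β] [Primcodable γ] {f g : γ → List β}
    (hf : Primrec f) (hg : Primrec g) : Primrec fun a => sameElems (f a) (g a) := by
  unfold sameElems
  fun_prop

end Enumerations

/-! ### Codes of layers -/

section LayerCodes

variable {n w : ℕ}

/-- The numerical form of transitions that occurs in codes of layers. -/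
def transCode (t : Fin w × Fin n × Fin w) : ℕ × ℕ × ℕ :=
  (t.1, t.2.1, t.2.2)

theorem transCode_injective : Function.Injective (transCode : Fin w × Fin n × Fin w → _) := by
  rintro ⟨p, a, q⟩ ⟨p', a', q'⟩ h
  simpa only [transCode, Prod.mk.injEq, Fin.val_inj] using h

/-- A layer together with one of its many codes. -/
structure CodedLayer (n w : ℕ) where
  code : LayerCode
  layer : Layer (Fin n) w
  describes : code.Describes layer

namespace CodedLayer

variable (z : CodedLayer n w)

theorem left : Enumerates Fin.val z.code.1 z.layer.left := z.describes.1

theorem right : Enumerates Fin.val z.code.2.1 z.layer.right := z.describes.2.1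

theorem trans : Enumerates transCode z.code.2.2.1 z.layer.trans := z.describes.2.2.1

theorem init : Enumerates Fin.val z.code.2.2.2.1 z.layer.init := z.describes.2.2.2.1

theorem final : Enumerates Fin.val z.code.2.2.2.2.1 z.layer.final := z.describes.2.2.2.2.1

theorem initFlag : z.code.2.2.2.2.2.1 = z.layer.initFlag := z.describes.2.2.2.2.2.1

theorem finalFlag : z.code.2.2.2.2.2.2 = z.layer.finalFlag := z.describes.2.2.2.2.2.2

end CodedLayer

/-- The test whether two codes describe the same layers. -/
def LayerCode.same (c d : LayerCode) : Bool :=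
  sameElems c.1 d.1 && sameElems c.2.1 d.2.1 && sameElems c.2.2.1 d.2.2.1 &&
    sameElems c.2.2.2.1 d.2.2.2.1 && sameElems c.2.2.2.2.1 d.2.2.2.2.1 &&
    c.2.2.2.2.2.1 == d.2.2.2.2.2.1 && c.2.2.2.2.2.2 == d.2.2.2.2.2.2

theorem CodedLayer.same_iff_describes (z : CodedLayer n w) {c : LayerCode} :
    c.same z.code = true ↔ c.Describes z.layer := by
  simp only [LayerCode.same, Bool.and_eq_true, beq_iff_eq, z.left.sameElems_iff,
    z.right.sameElems_iff, z.trans.sameElems_iff, z.init.sameElems_iff, z.final.sameElems_iff,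
    z.initFlag, z.finalFlag, and_assoc]
  rfl

/-- The test for the laws of a layer. -/
def LayerCode.valid (c : LayerCode) : Bool :=
  (c.2.2.1.all fun t => c.1.contains t.1 && c.2.1.contains t.2.2) &&
    (c.2.2.2.1.all fun p => c.1.contains p) && (c.2.2.2.2.1.all fun q => c.2.1.contains q) &&
    (c.2.2.2.2.2.1 || c.2.2.2.1.isEmpty) && (c.2.2.2.2.2.2 || c.2.2.2.2.1.isEmpty)

theorem LayerCode.valid_iff {c : LayerCode} {left right init final : Finset (Fin w)}
    {trans : Finset (Fin w × Fin n × Fin w)} (hl : Enumerates Fin.val c.1 left)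
    (hr : Enumerates Fin.val c.2.1 right) (ht : Enumerates transCode c.2.2.1 trans)
    (hi : Enumerates Fin.val c.2.2.2.1 init) (hf : Enumerates Fin.val c.2.2.2.2.1 final) :
    c.valid = true ↔
      (∀ t ∈ trans, t.1 ∈ left ∧ t.2.2 ∈ right) ∧ init ⊆ left ∧ final ⊆ right ∧
        (c.2.2.2.2.2.1 = false → init = ∅) ∧ (c.2.2.2.2.2.2 = false → final = ∅) := by
  simp only [LayerCode.valid, Bool.and_eq_true, Bool.or_eq_true, List.all_eq_true,
    hi.isEmpty_iff, hf.isEmpty_iff, ht.forall_mem_iff, hi.forall_mem_iff, hf.forall_mem_iff,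
    transCode, hl.contains_iff Fin.val_injective, hr.contains_iff Fin.val_injective,
    Finset.subset_iff, and_assoc, ← Bool.not_eq_true, or_iff_not_imp_left]

theorem enumerates_range : Enumerates Fin.val (List.range w) (Finset.univ : Finset (Fin w)) :=
  fun x => by simp [Fin.exists_iff]

/-- A list of the numerical forms of all possible transitions. -/
def transCodes (n w : ℕ) : List (ℕ × ℕ × ℕ) :=
  (List.range w).product ((List.range n).product (List.range w))

theorem enumerates_transCodes :
    Enumerates transCode (transCodes n w) (Finset.univ : Finset (Fin w × Fin n × Fin w)) := by
  rintro ⟨p, a, q⟩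
  simp [transCodes, transCode, Fin.exists_iff]

/-- A list that contains, for every layer of width `w` over the alphabet `Fin n`, one of its codes.
-/
def layerCodes (n w : ℕ) : List LayerCode :=
  ((List.range w).sublists'.product <| (List.range w).sublists'.product <|
    (transCodes n w).sublists'.product <| (List.range w).sublists'.product <|
    (List.range w).sublists'.product <| [false, true].product [false, true]).filter LayerCode.valid

theorem mem_layerCodes {c : LayerCode} :
    c ∈ layerCodes n w ↔ c.1 ∈ (List.range w).sublists' ∧ c.2.1 ∈ (List.range w).sublists' ∧
      c.2.2.1 ∈ (transCodes n w).sublists' ∧ c.2.2.2.1 ∈ (List.range w).sublists' ∧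
      c.2.2.2.2.1 ∈ (List.range w).sublists' ∧ c.valid = true := by
  obtain ⟨_, _, _, _, _, _, _⟩ := c
  have hmem : ∀ b, b ∈ [false, true] := by decide
  simp only [layerCodes, List.mem_filter, List.pair_mem_product, and_assoc, hmem, true_and]

theorem exists_code_eq {c : LayerCode} (hc : c ∈ layerCodes n w) :
    ∃ z : CodedLayer n w, z.code = c := by
  obtain ⟨hl, hr, ht, hi, hf, hvalid⟩ := mem_layerCodes.mp hc
  obtain ⟨left, hl⟩ := enumerates_range.exists_of_mem_sublists' hl
  obtain ⟨right, hr⟩ := enumerates_range.exists_of_mem_sublists' hr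
  obtain ⟨trans, ht⟩ := enumerates_transCodes.exists_of_mem_sublists' ht
  obtain ⟨init, hi⟩ := enumerates_range.exists_of_mem_sublists' hi
  obtain ⟨final, hf⟩ := enumerates_range.exists_of_mem_sublists' hf
  obtain ⟨h₁, h₂, h₃, h₄, h₅⟩ := (LayerCode.valid_iff hl hr ht hi hf).mp hvalid
  exact ⟨⟨c, ⟨left, right, trans, init, final, _, _, h₁, h₂, h₃, h₄, h₅⟩,
    hl, hr, ht, hi, hf, rfl, rfl⟩, rfl⟩

theorem exists_layer_eq (l : Layer (Fin n) w) :
    ∃ z : CodedLayer n w, z.code ∈ layerCodes n w ∧ z.layer = l := by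
  obtain ⟨a, ha, hl⟩ := enumerates_range.exists_mem_sublists' l.left
  obtain ⟨b, hb, hr⟩ := enumerates_range.exists_mem_sublists' l.right
  obtain ⟨t, ht', ht⟩ := enumerates_transCodes.exists_mem_sublists' l.trans
  obtain ⟨i, hi', hi⟩ := enumerates_range.exists_mem_sublists' l.init
  obtain ⟨f, hf', hf⟩ := enumerates_range.exists_mem_sublists' l.final
  let c : LayerCode := (a, b, t, i, f, l.initFlag, l.finalFlag)
  have hvalid : c.valid = true := (LayerCode.valid_iff hl hr ht hi hf).mpr
    ⟨l.trans_mem, l.init_subset, l.final_subset, l.init_eq_empty, l.final_eq_empty⟩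
  exact ⟨⟨c, l, hl, hr, ht, hi, hf, rfl, rfl⟩,
    mem_layerCodes.mpr ⟨ha, hb, ht', hi', hf', hvalid⟩, rfl⟩

@[fun_prop]
theorem primrec_layerCodes {α : Type*} [Primcodable α] {f g : α → ℕ} (hf : Primrec f)
    (hg : Primrec g) : Primrec fun a => layerCodes (f a) (g a) := by
  unfold layerCodes transCodes LayerCode.valid
  fun_prop

end LayerCodes

/-! ### Membership tests -/

section Chains

variable {α : Type*}

/-- The test whether `r` relates consecutive entries of a list. -/
def chainTest (r : α → α → Bool) (u : List α) : Bool :=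
  (List.range u.length).all fun i => u[i + 1]?.all fun y => u[i]?.all fun x => r x y

theorem chainTest_iff {r : α → α → Bool} {u : List α} :
    chainTest r u = true ↔ u.IsChain fun x y => r x y = true := by
  simp only [chainTest, List.isChain_iff_getElem, List.all_eq_true, List.mem_range,
    Option.all_eq_true, List.getElem?_eq_some_iff]
  constructor
  · intro h i hi
    exact h i (by lia) _ ⟨hi, rfl⟩ _ ⟨by lia, rfl⟩
  · rintro h i - _ ⟨hi, rfl⟩ _ ⟨-, rfl⟩
    exact h i hi

@[fun_prop]
theorem primrec_chainTest {β : Type*} [Primcodable α] [Primcodable β] {r : α → α → Bool}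
    {f : β → List α} (hr : Primrec fun x : α × α => r x.1 x.2) (hf : Primrec f) :
    Primrec fun a => chainTest r (f a) := by
  have : Primrec fun x : ((β × ℕ) × α) × α => r x.2 x.1.2 :=
    hr.comp (Primrec.pair Primrec.snd (Primrec.snd.comp Primrec.fst))
  unfold chainTest
  fun_prop

end Chains

section Decides

variable {n w W : ℕ}

/-- The Boolean test `q` for strings of codes decides membership in the set `T` of strings of
layers, whichever codes of the layers it is given. -/
def Decides (q : List LayerCode → Bool) (T : Set (List (Layer (Fin n) w))) : Prop :=
  ∀ z : List (CodedLayer n w), q (z.map CodedLayer.code) = true ↔ z.map CodedLayer.layer ∈ T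

/-- The test whether a string of codes describes an ordered decision diagram. -/
def oddTest (u : List LayerCode) : Bool :=
  !u.isEmpty && (u.head?.all fun c => c.2.2.2.2.2.1) &&
    chainTest (fun c d => sameElems d.1 c.2.1 && !c.2.2.2.2.2.2 && !d.2.2.2.2.2.1) u &&
      u.getLast?.all fun c => c.2.2.2.2.2.2

theorem decides_isODD : Decides oddTest {D : List (Layer (Fin n) w) | IsODD D} := by
  intro z
  have hchain (x y : CodedLayer n w) : sameElems y.code.1 x.code.2.1 = true ↔
      y.layer.left = x.layer.right := y.left.sameElems_iff_eq x.right Fin.val_injective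
  simp [oddTest, isODD_iff, chainTest_iff, List.isChain_map, hchain, CodedLayer.initFlag,
    CodedLayer.finalFlag, and_assoc, Option.all_eq_true]

/-- The test whether a code describes a deterministic layer. -/
def LayerCode.deterministicTest (c : LayerCode) : Bool :=
  (!c.2.2.2.2.2.1 || sameElems c.2.2.2.1 c.1 && c.1.any fun p => c.1.all fun p' => p' == p) &&
    c.2.2.1.all fun t => c.2.2.1.all fun t' =>
      !(t.1 == t'.1 && t.2.1 == t'.2.1) || t.2.2 == t'.2.2

theorem CodedLayer.deterministicTest_iff (z : CodedLayer n w) :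
    z.code.deterministicTest = true ↔ z.layer.Deterministic := by
  have hinit : sameElems z.code.2.2.2.1 z.code.1 = true ↔ z.layer.init = z.layer.left :=
    z.init.sameElems_iff_eq z.left Fin.val_injective
  have hcard : (∃ p ∈ z.layer.left, ∀ p' ∈ z.layer.left, p' = p) ↔ z.layer.left.card = 1 := by
    simp only [Finset.card_eq_one, Finset.eq_singleton_iff_unique_mem]
  simp only [LayerCode.deterministicTest, Layer.Deterministic, Bool.and_eq_true, Bool.or_eq_true,
    List.all_eq_true, List.any_eq_true, Bool.not_eq_eq_eq_not, Bool.not_true, hinit, hcard,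
    z.left.exists_mem_iff, z.left.forall_mem_iff, z.trans.forall_mem_iff, beq_iff_eq, transCode,
    Fin.val_inj, z.initFlag]
  simp only [← Bool.not_eq_true, ← imp_iff_not_or, Bool.and_eq_true, beq_iff_eq, Fin.val_inj]
  refine and_congr_right' ⟨fun h p _ a q _ q' _ ht ht' => h _ ht _ ht' ⟨rfl, rfl⟩, ?_⟩
  rintro h ⟨p, a, q⟩ ht ⟨p', a', q'⟩ ht' ⟨rfl, rfl⟩
  obtain ⟨hp, hq⟩ := z.layer.trans_mem _ ht
  exact h p hp a q hq q' (z.layer.trans_mem _ ht').2 ht ht'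

/-- The test whether a code describes a complete layer over the alphabet `Fin n`. -/
def LayerCode.completeTest (n : ℕ) (c : LayerCode) : Bool :=
  (!c.2.2.2.2.2.1 || !c.2.2.2.1.isEmpty) &&
    c.1.all fun p => (List.range n).all fun a => c.2.1.any fun q => c.2.2.1.contains (p, a, q)

theorem CodedLayer.completeTest_iff (z : CodedLayer n w) :
    z.code.completeTest n = true ↔ z.layer.Complete := by
  have htrans (p a q) : z.code.2.2.1.contains (Fin.val p, Fin.val a, Fin.val q) = true ↔
      (p, a, q) ∈ z.layer.trans := z.trans.contains_iff transCode_injective (y := (p, a, q))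
  simp only [LayerCode.completeTest, Layer.Complete, Bool.and_eq_true, Bool.or_eq_true,
    List.all_eq_true, List.any_eq_true, Bool.not_eq_eq_eq_not, Bool.not_true,
    z.left.forall_mem_iff, enumerates_range.forall_mem_iff, z.right.exists_mem_iff, htrans,
    z.initFlag]
  simp only [← Bool.not_eq_true, ← imp_iff_not_or, z.init.isEmpty_iff,
    ← Finset.nonempty_iff_ne_empty, Finset.mem_univ, true_imp_iff]

theorem decides_detODDs :
    Decides (fun u => oddTest u && u.all fun c => c.deterministicTest && c.completeTest n)
      (detODDs (Fin n) w) := by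
  intro z
  simp [detODDs, decides_isODD z, CodedLayer.deterministicTest_iff, CodedLayer.completeTest_iff]

end Decides

section SameLanguage

variable {n w W : ℕ}

theorem Enumerates.exists_words_iff {α β : Type*} [Fintype α] {v : α → β} {L : List β}
    (hL : Enumerates v L Finset.univ) {k : ℕ} {P : List β → Prop} :
    (∃ u ∈ words L k, P u) ↔ ∃ s : List α, s.length = k ∧ P (s.map v) := by
  have hmem (x) : x ∈ L ↔ x ∈ Set.range v := by simp [hL x]
  constructor
  · rintro ⟨u, hu, hP⟩
    obtain ⟨hlen, hu⟩ := mem_words.mp hu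
    obtain ⟨s, rfl⟩ : u ∈ Set.range (List.map v) := by
      rw [Set.range_list_map]
      exact fun x hx => (hmem x).mp (hu x hx)
    exact ⟨s, by rwa [List.length_map] at hlen, hP⟩
  · rintro ⟨s, rfl, hP⟩
    exact ⟨_, mem_words.mpr ⟨List.length_map _, by simp [hmem]⟩, hP⟩

theorem exists_words_layerCodes_iff {q : List LayerCode → Bool}
    {T : Set (List (Layer (Fin n) w))} (hq : Decides q T) {k : ℕ} :
    (∃ u ∈ words (layerCodes n w) k, q u = true) ↔ ∃ D ∈ T, D.length = k := by
  constructor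
  · rintro ⟨u, hu, hqu⟩
    obtain ⟨hlen, hu⟩ := mem_words.mp hu
    obtain ⟨z, rfl⟩ : u ∈ Set.range (List.map CodedLayer.code) := by
      rw [Set.range_list_map]
      exact fun c hc => exists_code_eq (n := n) (w := w) (hu c hc)
    exact ⟨_, (hq z).mp hqu, by simpa using hlen⟩
  · rintro ⟨D, hD, rfl⟩
    choose f hcode hlayer using exists_layer_eq (n := n) (w := w)
    have hmap : (D.map f).map CodedLayer.layer = D := by simp [Function.comp_def, hlayer]
    exact ⟨(D.map f).map CodedLayer.code, mem_words.mpr ⟨by simp, by simp [hcode]⟩,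
      (hq _).mpr (by rwa [hmap])⟩

/-- The test whether a string of codes accepts a string of letters. -/
def stringTest (u : List LayerCode) (s : List ℕ) : Bool :=
  (u.map fun c => c.2.2.1).sections.any fun t =>
    t.map (fun x => x.2.1) == s && chainTest (fun x y => y.1 == x.2.2) t &&
      (t.head?.all fun x => u.head?.all fun c => c.2.2.2.1.contains x.1) &&
        t.getLast?.all fun x => u.getLast?.all fun c => c.2.2.2.2.1.contains x.2.2

theorem exists_mem_sections_iff {z : List (CodedLayer n w)} {P : List (ℕ × ℕ × ℕ) → Prop} :
    (∃ t ∈ ((z.map CodedLayer.code).map fun c => c.2.2.1).sections, P t) ↔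
      ∃ t, List.Forall₂ (fun x l => x ∈ l.trans) t (z.map CodedLayer.layer) ∧
        P (t.map transCode) := by
  have hmap (t) : List.Forall₂ (fun x l => x ∈ l.trans) t (z.map CodedLayer.layer) ↔
      t.map transCode ∈ ((z.map CodedLayer.code).map fun c => c.2.2.1).sections := by
    simp only [List.mem_sections, List.forall₂_map_left_iff, List.forall₂_map_right_iff,
      (CodedLayer.trans _).apply_mem_iff transCode_injective]
  simp only [hmap]
  refine ⟨?_, fun ⟨t, ht, hP⟩ => ⟨_, ht, hP⟩⟩
  rintro ⟨u, hu, hP⟩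
  obtain ⟨t, rfl⟩ : ∃ t : List (Fin w × Fin n × Fin w), t.map transCode = u := by
    rw [List.map_map, List.mem_sections, List.forall₂_map_right_iff] at hu
    refine exists_map_eq_of_forall₂ hu fun x l hx => ?_
    obtain ⟨y, -, hy⟩ := (l.trans x).mp hx
    exact ⟨y, hy⟩
  exact ⟨t, hu, hP⟩

theorem stringTest_iff {z : List (CodedLayer n w)} {s : List (Fin n)} :
    stringTest (z.map CodedLayer.code) (s.map Fin.val) = true ↔
      s ∈ (oddLang (z.map CodedLayer.layer)).2 := by
  have hlabel (t : List (Fin w × Fin n × Fin w)) :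
      (t.map transCode).map (fun x => x.2.1) = s.map Fin.val ↔ t.map (fun x => x.2.1) = s := by
    rw [← (List.map_injective_iff.mpr Fin.val_injective).eq_iff, List.map_map, List.map_map]
    rfl
  have hinit (z : CodedLayer n w) (p) : z.code.2.2.2.1.contains (Fin.val p) = true ↔
    p ∈ z.layer.init := z.init.contains_iff Fin.val_injective
  have hfinal (z : CodedLayer n w) (p) : z.code.2.2.2.2.1.contains (Fin.val p) = true ↔
    p ∈ z.layer.final := z.final.contains_iff Fin.val_injective
  simp only [stringTest, List.any_eq_true, exists_mem_sections_iff]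
  refine exists_congr fun t => ?_
  simp only [IsAcceptingSeq, Bool.and_eq_true, beq_iff_eq, hlabel, chainTest_iff, List.isChain_map,
    List.head?_map, List.getLast?_map, Option.all_map, Option.all_eq_true, Option.forall_mem_map]
  simp only [transCode, Fin.val_inj, hinit, hfinal]
  tauto

/-- The test whether two strings of codes over the alphabet `Fin n` describe strings of layers with
the same language. -/
def sameLangTest (n : ℕ) (u u' : List LayerCode) : Bool :=
  u.length == u'.length &&
    (words (List.range n) u.length).all fun s => stringTest u s == stringTest u' s

theorem sameLangTest_iff {z : List (CodedLayer n w)} {z' : List (CodedLayer n W)} :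
    sameLangTest n (z.map CodedLayer.code) (z'.map CodedLayer.code) = true ↔
      oddLang (z.map CodedLayer.layer) = oddLang (z'.map CodedLayer.layer) := by
  have hletters (k : ℕ) (P : List ℕ → Prop) : (∀ s ∈ words (List.range n) k, P s) ↔
      ∀ s : List (Fin n), s.length = k → P (s.map Fin.val) := by
    simpa using not_congr (enumerates_range.exists_words_iff (k := k) (P := fun s => ¬ P s))
  simp only [sameLangTest, Bool.and_eq_true, beq_iff_eq, List.all_eq_true, List.length_map,
    hletters, oddLang_eq_iff, ← stringTest_iff, Bool.coe_iff_coe]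

/-- The test whether a string of codes has the same language as some string of layers of width `w`
over the alphabet `Fin n` that passes the test `q`. -/
def saturationTest (n w : ℕ) (q : List LayerCode → Bool) (u : List LayerCode) : Bool :=
  (words (layerCodes n w) u.length).any fun v => q v && sameLangTest n v u

theorem Decides.saturationTest {q : List LayerCode → Bool} {K : Set (List (Layer (Fin n) w))}
    (hq : Decides q K) :
    Decides (saturationTest n w q) (oddLang ⁻¹' (oddLang '' K) : Set (List (Layer (Fin n) W))) := by
  intro z'
  have hsame : Decides (fun v => q v && sameLangTest n v (z'.map CodedLayer.code))
      {D | D ∈ K ∧ oddLang D = oddLang (z'.map CodedLayer.layer)} := fun z => by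
    rw [Bool.and_eq_true, hq z, sameLangTest_iff]
    rfl
  rw [SOFA.saturationTest, List.any_eq_true, exists_words_layerCodes_iff hsame]
  refine exists_congr fun D => and_iff_left_of_imp fun h => ?_
  simpa [oddLang] using congrArg Prod.fst h.2

end SameLanguage

section Acceptance

variable {n w : ℕ} {c : AutCode}

/-- The list of states that an automaton with code `c` can reach from a state in the list `S` by
reading the layer with code `d`. -/
def AutCode.step (c : AutCode) (S : List ℕ) (d : LayerCode) : List ℕ :=
  (List.range c.1).filter fun q =>
    c.2.2.2.any fun e => S.contains e.1 && e.2.1.same d && e.2.2 == q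

/-- The test whether the automaton with code `c` accepts the layers with given codes. -/
def AutCode.acceptTest (c : AutCode) (u : List LayerCode) : Bool :=
  (u.foldl c.step ((List.range c.1).filter c.2.1.contains)).any c.2.2.1.contains

theorem AutCode.mem_filter_range {p : ℕ → Bool} {x : ℕ} :
    x ∈ (List.range c.1).filter p ↔ ∃ q : Fin c.1, p q = true ∧ q.val = x := by
  simp only [List.mem_filter, List.mem_range, Fin.exists_iff]
  grind

theorem AutCode.mem_step {S : List ℕ} {S' : Set (Fin c.1)} {z : CodedLayer n w}
    (hS : ∀ x, x ∈ S ↔ ∃ q ∈ S', q.val = x) (x : ℕ) :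
    x ∈ c.step S z.code ↔ ∃ q ∈ (c.toNFA n w).stepSet S' z.layer, q.val = x := by
  rw [AutCode.step, mem_filter_range]
  refine exists_congr fun q => and_congr_left' ?_
  simp only [List.any_eq_true, Bool.and_eq_true, List.contains_iff_mem, hS, beq_iff_eq,
    z.same_iff_describes, NFA.mem_stepSet, AutCode.toNFA, Set.mem_ofPred_eq]
  constructor
  · rintro ⟨⟨p, d, _⟩, he, ⟨⟨p, hp, rfl⟩, hd⟩, rfl⟩
    exact ⟨p, hp, d, hd, he⟩
  · rintro ⟨p, hp, d, hd, he⟩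
    exact ⟨_, he, ⟨⟨p, hp, rfl⟩, hd⟩, rfl⟩

theorem AutCode.mem_foldl_step {z : List (CodedLayer n w)} {S : List ℕ} {S' : Set (Fin c.1)}
    (hS : ∀ x, x ∈ S ↔ ∃ q ∈ S', q.val = x) (x : ℕ) :
    x ∈ (z.map CodedLayer.code).foldl c.step S ↔
      ∃ q ∈ (c.toNFA n w).evalFrom S' (z.map CodedLayer.layer), q.val = x := by
  induction z generalizing S S' with
  | nil => exact hS x
  | cons y z ih =>
    rw [List.map_cons, List.map_cons, List.foldl_cons, NFA.evalFrom_cons]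
    exact ih (mem_step hS)

theorem AutCode.decides_accepts (c : AutCode) :
    Decides c.acceptTest (c.toNFA n w).accepts := by
  intro z
  have hstart (x) : x ∈ (List.range c.1).filter c.2.1.contains ↔
      ∃ q ∈ (c.toNFA n w).start, q.val = x := by
    simp only [mem_filter_range, List.contains_iff_mem, AutCode.toNFA, Set.mem_ofPred_eq]
  simp only [acceptTest, List.any_eq_true, mem_foldl_step hstart, List.contains_iff_mem]
  constructor
  · rintro ⟨_, ⟨q, hq, rfl⟩, hacc⟩
    exact ⟨q, hacc, hq⟩
  · rintro ⟨q, hacc, hq⟩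
    exact ⟨_, ⟨q, hq, rfl⟩, hacc⟩

end Acceptance

section PrimitiveRecursiveTests

variable {α : Type*} [Primcodable α] {u u' : α → List LayerCode} {d : α → LayerCode} {n w : α → ℕ}

@[fun_prop]
theorem primrec_oddTest (hu : Primrec u) : Primrec fun a => oddTest (u a) := by
  unfold oddTest
  fun_prop

@[fun_prop]
theorem primrec_deterministicTest (hd : Primrec d) :
    Primrec fun a => (d a).deterministicTest := by
  unfold LayerCode.deterministicTest
  fun_prop

@[fun_prop]
theorem primrec_completeTest (hn : Primrec n) (hd : Primrec d) :
    Primrec fun a => (d a).completeTest (n a) := by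
  unfold LayerCode.completeTest
  fun_prop

@[fun_prop]
theorem primrec_stringTest {s : α → List ℕ} (hu : Primrec u) (hs : Primrec s) :
    Primrec fun a => stringTest (u a) (s a) := by
  unfold stringTest
  fun_prop

@[fun_prop]
theorem primrec_sameLangTest (hn : Primrec n) (hu : Primrec u) (hu' : Primrec u') :
    Primrec fun a => sameLangTest (n a) (u a) (u' a) := by
  unfold sameLangTest
  fun_prop

@[fun_prop]
theorem primrec_saturationTest {q : α → List LayerCode → Bool} (hn : Primrec n) (hw : Primrec w)
    (hq : Primrec fun x : α × List LayerCode => q x.1 x.2) (hu : Primrec u) :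
    Primrec fun a => saturationTest (n a) (w a) (q a) (u a) := by
  unfold saturationTest
  fun_prop

@[fun_prop]
theorem primrec_same {d' : α → LayerCode} (hd : Primrec d) (hd' : Primrec d') :
    Primrec fun a => (d a).same (d' a) := by
  unfold LayerCode.same
  fun_prop

@[fun_prop]
theorem primrec_step {c : α → AutCode} {S : α → List ℕ} (hc : Primrec c) (hS : Primrec S)
    (hd : Primrec d) : Primrec fun a => (c a).step (S a) (d a) := by
  unfold AutCode.step
  fun_prop

@[fun_prop]
theorem primrec_acceptTest {c : α → AutCode} (hc : Primrec c) (hu : Primrec u) :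
    Primrec fun a => (c a).acceptTest (u a) := by
  unfold AutCode.acceptTest
  fun_prop

end PrimitiveRecursiveTests

/-! ### Effectively regular families -/

section EffectivelyRegular

variable {α : Type*} [Primcodable α] {n w W : α → ℕ}

/-- A family of sets of strings of layers is effectively regular if membership in its sets is
decided by a primitive recursive test on codes and their state complexity has a primitive recursive
bound. Such a bound makes emptiness and the search for an automaton effective. -/
def EffectivelyRegular (n w : α → ℕ) (T : ∀ a, Set (List (Layer (Fin (n a)) (w a)))) : Prop :=
  ∃ (N : α → ℕ) (q : α → List LayerCode → Bool), Primrec N ∧ Primrec₂ q ∧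
    ∀ a, StateComplexityLE (T a) (N a) ∧ Decides (q a) (T a)

variable {T T₁ T₂ K : ∀ a, Set (List (Layer (Fin (n a)) (w a)))}

theorem EffectivelyRegular.inter (h₁ : EffectivelyRegular n w T₁)
    (h₂ : EffectivelyRegular n w T₂) : EffectivelyRegular n w fun a => T₁ a ∩ T₂ a := by
  obtain ⟨N₁, q₁, hN₁, hq₁, h₁⟩ := h₁
  obtain ⟨N₂, q₂, hN₂, hq₂, h₂⟩ := h₂
  refine ⟨fun a => N₁ a * N₂ a, fun a u => q₁ a u && q₂ a u, by fun_prop,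
    Primrec.and.comp₂ hq₁ hq₂, fun a => ⟨(h₁ a).1.inter (h₂ a).1, fun z => ?_⟩⟩
  rw [Bool.and_eq_true, (h₁ a).2 z, (h₂ a).2 z, Set.mem_inter_iff]

theorem EffectivelyRegular.compl (h : EffectivelyRegular n w T) :
    EffectivelyRegular n w fun a => (T a)ᶜ := by
  obtain ⟨N, q, hN, hq, h⟩ := h
  refine ⟨N, fun a u => !q a u, hN, Primrec.not.comp₂ hq, fun a => ⟨(h a).1.compl, fun z => ?_⟩⟩
  rw [Bool.not_eq_true', ← Bool.not_eq_true, (h a).2 z, Set.mem_compl_iff]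

theorem EffectivelyRegular.diff (h₁ : EffectivelyRegular n w T₁)
    (h₂ : EffectivelyRegular n w T₂) : EffectivelyRegular n w fun a => T₁ a \ T₂ a :=
  h₁.inter h₂.compl

theorem EffectivelyRegular.union (h₁ : EffectivelyRegular n w T₁)
    (h₂ : EffectivelyRegular n w T₂) : EffectivelyRegular n w fun a => T₁ a ∪ T₂ a := by
  simpa only [Set.union_eq_compl_compl_inter_compl] using (h₁.compl.inter h₂.compl).compl

theorem EffectivelyRegular.symmDiff (h₁ : EffectivelyRegular n w T₁)
    (h₂ : EffectivelyRegular n w T₂) : EffectivelyRegular n w fun a => symmDiff (T₁ a) (T₂ a) :=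
  (h₁.diff h₂).union (h₂.diff h₁)

theorem EffectivelyRegular.comp {β : Type*} [Primcodable β] (h : EffectivelyRegular n w T)
    {f : β → α} (hf : Primrec f) :
    EffectivelyRegular (fun b => n (f b)) (fun b => w (f b)) fun b => T (f b) := by
  obtain ⟨N, q, hN, hq, h⟩ := h
  exact ⟨fun b => N (f b), fun b => q (f b), hN.comp hf,
    hq.comp₂ (hf.comp₂ Primrec₂.left) Primrec₂.right, fun b => h (f b)⟩

theorem effectivelyRegular_isODD (hw : Primrec w) :
    EffectivelyRegular n w fun _ => {D | IsODD D} := by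
  refine ⟨fun a => 2 * (2 ^ w a * 2 + 1), fun _ => oddTest, by fun_prop,
    by unfold Primrec₂; fun_prop, fun a => ⟨?_, decides_isODD⟩⟩
  simpa using stateComplexityLE_isODD (A := Fin (n a)) (w := w a) fun _ => True

theorem effectivelyRegular_detODDs (hn : Primrec n) (hw : Primrec w) :
    EffectivelyRegular n w fun a => detODDs (Fin (n a)) (w a) :=
  ⟨fun a => 2 * (2 ^ w a * 2 + 1),
    fun a u => oddTest u && u.all fun c => c.deterministicTest && c.completeTest (n a),
    by fun_prop, by unfold Primrec₂; fun_prop,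
    fun _ => ⟨stateComplexityLE_isODD _, decides_detODDs⟩⟩

theorem effectivelyRegular_accepts {c : α → AutCode} (hc : Primrec c) :
    EffectivelyRegular n w fun a => ((c a).toNFA (n a) (w a)).accepts := by
  refine ⟨fun a => 2 ^ (c a).1, fun a => (c a).acceptTest, by fun_prop,
    by unfold Primrec₂; fun_prop, fun a => ⟨?_, AutCode.decides_accepts _⟩⟩
  simpa using StateComplexityLE.of_nfa ((c a).toNFA (n a) (w a))

theorem EffectivelyRegular.oddLang_preimage_image (hn : Primrec n) (hw : Primrec w)
    (hW : Primrec W) (hK : EffectivelyRegular n w K) :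
    EffectivelyRegular n W fun a => oddLang ⁻¹' (oddLang '' K a) := by
  obtain ⟨N, q, hN, hq, hK⟩ := hK
  have hq' : Primrec fun x : (α × List LayerCode) × List LayerCode => q x.1.1 x.2 :=
    hq.comp (Primrec.fst.comp Primrec.fst) Primrec.snd
  refine ⟨fun a => 2 ^ (N a * sameLangPairsBound (w a) (W a)),
    fun a => saturationTest (n a) (w a) (q a), ?_,
    primrec_saturationTest (hn.comp Primrec.fst) (hw.comp Primrec.fst) hq' Primrec.snd,
    fun a => ⟨(hK a).1.oddLang_preimage_image, (hK a).2.saturationTest⟩⟩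
  unfold sameLangPairsBound acceptedPairsBound
  fun_prop

theorem EffectivelyRegular.primrecPred_eq_empty (hn : Primrec n) (hw : Primrec w)
    (hT : EffectivelyRegular n w T) : PrimrecPred fun a => T a = ∅ := by
  obtain ⟨N, q, hN, hq, hT⟩ := hT
  have hq' : Primrec fun x : (α × ℕ) × List LayerCode => q x.1.1 x.2 :=
    hq.comp (Primrec.fst.comp Primrec.fst) Primrec.snd
  have htest : Primrec fun a => (List.range (N a)).any fun k =>
      (words (layerCodes (n a) (w a)) k).any (q a) :=
    primrec_any (by fun_prop) (primrec_any (by fun_prop) hq')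
  refine (Primrec.eq.comp htest (Primrec.const false)).of_eq fun a => ?_
  have hshort : (∃ k < N a, ∃ D ∈ T a, D.length = k) ↔ (T a).Nonempty :=
    ⟨fun ⟨_, _, D, hD, _⟩ => ⟨D, hD⟩, fun h =>
      let ⟨D, hD, hlt⟩ := (hT a).1.exists_length_lt h
      ⟨_, hlt, D, hD, rfl⟩⟩
  rw [← Bool.not_eq_true, ← Set.not_nonempty_iff_eq_empty, ← hshort]
  simp only [List.any_eq_true, List.mem_range, exists_words_layerCodes_iff (hT a).2]

theorem exists_computable_choice {β : Type*} [Primcodable β] {p : α → β → Prop}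
    (hp : PrimrecRel p) (h : ∀ a, ∃ b, p a b) : ∃ f : α → β, Computable f ∧ ∀ a, p a (f a) := by
  classical
  let g (a : α) (k : ℕ) : Option β := (Encodable.decode k).bind (Option.guard fun b => p a b)
  have hg : Primrec₂ g := Primrec.option_bind (Primrec.decode.comp Primrec.snd)
    (Primrec.option_guard (p := fun (x : (α × ℕ) × β) b => p x.1.1 b)
      (hp.comp (Primrec.fst.comp (Primrec.fst.comp Primrec.fst)) Primrec.snd) Primrec.snd)
  have hdom (a) : (Nat.rfindOpt (g a)).Dom := by
    obtain ⟨b, hb⟩ := h a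
    exact Nat.rfindOpt_dom.mpr ⟨Encodable.encode b, b, by simp [g, hb]⟩
  refine ⟨fun a => (Nat.rfindOpt (g a)).get (hdom a),
    (Partrec.rfindOpt hg.to_comp).of_eq_tot fun a => Part.get_mem _, fun a => ?_⟩
  obtain ⟨k, hk⟩ := Nat.rfindOpt_spec (Part.get_mem (hdom a))
  obtain ⟨b, -, hb⟩ := Option.bind_eq_some_iff.mp hk
  obtain ⟨rfl, hpb⟩ := Option.guard_eq_some_iff.mp hb
  exact of_decide_eq_true hpb

theorem EffectivelyRegular.exists_computable_code (hn : Primrec n) (hw : Primrec w)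
    (hT : EffectivelyRegular n w T) :
    ∃ f : α → AutCode, Computable f ∧ ∀ a, ((f a).toNFA (n a) (w a)).accepts = T a := by
  have hdiff := ((effectivelyRegular_accepts (α := α × AutCode) (n := fun x => n x.1)
    (w := fun x => w x.1) Primrec.snd).symmDiff (hT.comp Primrec.fst)).primrecPred_eq_empty
    (hn.comp Primrec.fst) (hw.comp Primrec.fst)
  have hsame : PrimrecRel fun a (c : AutCode) => (c.toNFA (n a) (w a)).accepts = T a :=
    hdiff.of_eq fun _ => symmDiff_eq_bot
  refine exists_computable_choice hsame fun a => ?_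
  obtain ⟨N, q, -, -, hT⟩ := hT
  obtain ⟨m, G, hG⟩ := (hT a).1.exists_nfa
  obtain ⟨S, R, E, hc⟩ := exists_code G
  exact ⟨(m, S, R, E), by rw [hc, hG]⟩

end EffectivelyRegular

/-! ### Second languages -/

section SecondLanguages

variable {A : Type*} {w W : ℕ}

theorem stateComplexityLE_preimage_secondLang {σ : Type*} [Finite σ] (F : NFA (Layer A w) σ) :
    StateComplexityLE (oddLang ⁻¹' secondLang F : Set (List (Layer A W)))
      (2 ^ (2 ^ Nat.card σ * sameLangPairsBound w W)) :=
  (StateComplexityLE.of_nfa F).oddLang_preimage_image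

theorem stateComplexityLE_preimage_detLangs :
    StateComplexityLE (oddLang ⁻¹' detLangs A w : Set (List (Layer A W)))
      (2 ^ (2 * (2 ^ w * 2 + 1) * sameLangPairsBound w W)) :=
  detLangs_eq_image (A := A) ▸ (stateComplexityLE_isODD _).oddLang_preimage_image

theorem IsSOFA.secondLang_subset_of_le {σ : Type*} {F : NFA (Layer A w) σ} (hF : IsSOFA F)
    (hw : w ≤ W) : secondLang F ⊆ oddLangs A W :=
  hF.secondLang_subset.trans (oddLangs_mono hw)

theorem widthCompl_subset (L : Set (ℕ × Set (List A))) (hw : w ≤ W) :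
    widthCompl w L ⊆ oddLangs A W :=
  Set.sdiff_subset.trans (detLangs_subset.trans (oddLangs_mono hw))

theorem exists_secondLang_eq {X : Set (ℕ × Set (List A))} {N : ℕ}
    (hX : StateComplexityLE (oddLang ⁻¹' X : Set (List (Layer A W))) N) (hsub : X ⊆ oddLangs A W) :
    ∃ (m : ℕ) (G : NFA (Layer A W) (Fin m)), IsSOFA G ∧ secondLang G = X := by
  have hODD := stateComplexityLE_isODD (A := A) (w := W) fun _ => True
  simp only [implies_true, and_true] at hODD
  obtain ⟨m, G, hG⟩ := (hODD.inter hX).exists_nfa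
  exact ⟨m, G, isSOFA_and_secondLang_eq hsub hG⟩

variable {α : Type*} [Primcodable α] {n w W : α → ℕ}
  {X X₁ X₂ : ∀ a, Set (ℕ × Set (List (Fin (n a))))}

/-- A family of classes of length-typed languages is effectively regular at width `W` if the strings
of layers of width `W` whose language belongs to the class form an effectively regular family. -/
def EffectivelyRegularClass (n W : α → ℕ) (X : ∀ a, Set (ℕ × Set (List (Fin (n a))))) : Prop :=
  EffectivelyRegular n W fun a => oddLang ⁻¹' X a

theorem EffectivelyRegularClass.inter (h₁ : EffectivelyRegularClass n W X₁)
    (h₂ : EffectivelyRegularClass n W X₂) : EffectivelyRegularClass n W fun a => X₁ a ∩ X₂ a :=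
  EffectivelyRegular.inter h₁ h₂

theorem EffectivelyRegularClass.union (h₁ : EffectivelyRegularClass n W X₁)
    (h₂ : EffectivelyRegularClass n W X₂) : EffectivelyRegularClass n W fun a => X₁ a ∪ X₂ a :=
  EffectivelyRegular.union h₁ h₂

theorem EffectivelyRegularClass.diff (h₁ : EffectivelyRegularClass n W X₁)
    (h₂ : EffectivelyRegularClass n W X₂) : EffectivelyRegularClass n W fun a => X₁ a \ X₂ a :=
  EffectivelyRegular.diff h₁ h₂

theorem effectivelyRegularClass_secondLang {c : α → AutCode} (hn : Primrec n) (hw : Primrec w)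
    (hW : Primrec W) (hc : Primrec c) :
    EffectivelyRegularClass n W fun a => (c a).secondLang (n a) (w a) :=
  (effectivelyRegular_accepts hc).oddLang_preimage_image hn hw hW

theorem effectivelyRegularClass_detLangs (hn : Primrec n) (hw : Primrec w) (hW : Primrec W) :
    EffectivelyRegularClass n W fun a => detLangs (Fin (n a)) (w a) := by
  simpa only [EffectivelyRegularClass, detLangs_eq_image] using
    (effectivelyRegular_detODDs hn hw).oddLang_preimage_image hn hw hW

theorem EffectivelyRegularClass.exists_computable_secondLang_eq (hn : Primrec n) (hW : Primrec W)
    (hX : EffectivelyRegularClass n W X) :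
    ∃ f : α → AutCode, Computable f ∧ ∀ a, X a ⊆ oddLangs (Fin (n a)) (W a) →
      (f a).IsSOFA (n a) (W a) ∧ (f a).secondLang (n a) (W a) = X a := by
  obtain ⟨f, hf, h⟩ := ((effectivelyRegular_isODD hW).inter hX).exists_computable_code hn hW
  exact ⟨f, hf, fun a hsub => isSOFA_and_secondLang_eq hsub (h a)⟩

theorem EffectivelyRegularClass.exists_computable_isEmpty (hn : Primrec n) (hw : Primrec w)
    (hX : EffectivelyRegularClass n w X) :
    ∃ f : α → Bool, Computable f ∧ ∀ a,
      X a ⊆ Set.range (oddLang : List (Layer (Fin (n a)) (w a)) → _) → (f a = true ↔ X a = ∅) := by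
  obtain ⟨_, h⟩ := EffectivelyRegular.primrecPred_eq_empty hn hw hX
  refine ⟨_, h.to_comp, fun a hsub => decide_eq_true_iff.trans ?_⟩
  change oddLang ⁻¹' X a = ∅ ↔ _
  rw [← Set.image_eq_empty (f := oddLang), Set.image_preimage_eq_of_subset hsub]

theorem AutCode.secondLang_subset_range_oddLang (c : AutCode) (n w : ℕ) :
    c.secondLang n w ⊆ Set.range (oddLang : List (Layer (Fin n) w) → _) :=
  Set.image_subset_range oddLang (c.toNFA n w).accepts

end SecondLanguages

section Closure

variable {A σ₁ σ₂ : Type*} {w W : ℕ} {F₁ : NFA (Layer A w) σ₁} {F₂ : NFA (Layer A w) σ₂}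

theorem IsSOFA.exists_inter [Finite σ₁] [Finite σ₂] (h₁ : IsSOFA F₁) (hW : w ≤ W) :
    ∃ (m : ℕ) (G : NFA (Layer A W) (Fin m)), IsSOFA G ∧
      secondLang G = secondLang F₁ ∩ secondLang F₂ :=
  exists_secondLang_eq
    ((stateComplexityLE_preimage_secondLang F₁).inter (stateComplexityLE_preimage_secondLang F₂))
    (Set.inter_subset_left.trans (h₁.secondLang_subset_of_le hW))

theorem IsSOFA.exists_union [Finite σ₁] [Finite σ₂] (h₁ : IsSOFA F₁) (h₂ : IsSOFA F₂)
    (hW : w ≤ W) :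
    ∃ (m : ℕ) (G : NFA (Layer A W) (Fin m)), IsSOFA G ∧
      secondLang G = secondLang F₁ ∪ secondLang F₂ :=
  exists_secondLang_eq
    ((stateComplexityLE_preimage_secondLang F₁).union (stateComplexityLE_preimage_secondLang F₂))
    (Set.union_subset (h₁.secondLang_subset_of_le hW) (h₂.secondLang_subset_of_le hW))

theorem IsSOFA.exists_diff [Finite σ₁] [Finite σ₂] (h₁ : IsSOFA F₁) (hW : w ≤ W) :
    ∃ (m : ℕ) (G : NFA (Layer A W) (Fin m)), IsSOFA G ∧
      secondLang G = secondLang F₁ \ secondLang F₂ :=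
  exists_secondLang_eq
    ((stateComplexityLE_preimage_secondLang F₁).diff (stateComplexityLE_preimage_secondLang F₂))
    (Set.sdiff_subset.trans (h₁.secondLang_subset_of_le hW))

theorem exists_secondLang_eq_detLangs (A : Type*) (w : ℕ) :
    ∃ (m : ℕ) (G : NFA (Layer A w) (Fin m)), IsSOFA G ∧ secondLang G = detLangs A w :=
  exists_secondLang_eq stateComplexityLE_preimage_detLangs detLangs_subset

theorem exists_secondLang_eq_widthCompl {σ : Type*} [Finite σ] (F : NFA (Layer A w) σ) {w' : ℕ}
    (hW : w' ≤ W) :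
    ∃ (m : ℕ) (G : NFA (Layer A W) (Fin m)), IsSOFA G ∧
      secondLang G = widthCompl w' (secondLang F) :=
  exists_secondLang_eq
    (stateComplexityLE_preimage_detLangs.diff (stateComplexityLE_preimage_secondLang F))
    (widthCompl_subset _ hW)

end Closure

section UniformClosure

variable {W : ℕ → ℕ}

theorem effectivelyRegularClass_secondLang_fst (hW : Primrec W) :
    EffectivelyRegularClass (α := ℕ × ℕ × AutCode × AutCode) (·.1) (fun x => W x.2.1)
      fun x => AutCode.secondLang x.1 x.2.1 x.2.2.1 :=
  effectivelyRegularClass_secondLang .fst (by fun_prop) (by fun_prop) (by fun_prop)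

theorem effectivelyRegularClass_secondLang_snd (hW : Primrec W) :
    EffectivelyRegularClass (α := ℕ × ℕ × AutCode × AutCode) (·.1) (fun x => W x.2.1)
      fun x => AutCode.secondLang x.1 x.2.1 x.2.2.2 :=
  effectivelyRegularClass_secondLang .fst (by fun_prop) (by fun_prop) (by fun_prop)

theorem effectivelyRegularClass_widthCompl (hW : Primrec W) :
    EffectivelyRegularClass (α := ℕ × ℕ × ℕ × AutCode) (·.1) (fun x => W (max x.2.1 x.2.2.1))
      fun x => widthCompl x.2.2.1 (AutCode.secondLang x.1 x.2.1 x.2.2.2) :=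
  (effectivelyRegularClass_detLangs .fst (by fun_prop) (by fun_prop)).diff
    (effectivelyRegularClass_secondLang .fst (by fun_prop) (by fun_prop) (by fun_prop))

end UniformClosure

end SOFA

theorem theorem4p1_general (W : ℕ → ℕ) (hW : Primrec W) (hle : ∀ w, w ≤ W w) :
    (∀ (A : Type*) (w : ℕ) (σ σ₁ σ₂ : Type*) [Finite σ] [Finite σ₁] [Finite σ₂]
        (F : NFA (SOFA.Layer A w) σ) (F₁ : NFA (SOFA.Layer A w) σ₁)
        (F₂ : NFA (SOFA.Layer A w) σ₂),
        SOFA.IsSOFA F₁ → SOFA.IsSOFA F₂ →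
        (∃ (m : ℕ) (G : NFA (SOFA.Layer A (W w)) (Fin m)), SOFA.IsSOFA G ∧
          SOFA.secondLang G = SOFA.secondLang F₁ ∩ SOFA.secondLang F₂) ∧
        (∃ (m : ℕ) (G : NFA (SOFA.Layer A (W w)) (Fin m)), SOFA.IsSOFA G ∧
          SOFA.secondLang G = SOFA.secondLang F₁ ∪ SOFA.secondLang F₂) ∧
        (∃ (m : ℕ) (G : NFA (SOFA.Layer A (W w)) (Fin m)), SOFA.IsSOFA G ∧
          SOFA.secondLang G = SOFA.secondLang F₁ \ SOFA.secondLang F₂) ∧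
        (∃ (m : ℕ) (G : NFA (SOFA.Layer A w) (Fin m)), SOFA.IsSOFA G ∧
          SOFA.secondLang G = SOFA.detLangs A w) ∧
        (∀ w' : ℕ,
          ∃ (m : ℕ) (G : NFA (SOFA.Layer A (W (max w w'))) (Fin m)), SOFA.IsSOFA G ∧
            SOFA.secondLang G = SOFA.widthCompl w' (SOFA.secondLang F))) ∧
    (∃ cap : ℕ × ℕ × SOFA.AutCode × SOFA.AutCode → SOFA.AutCode, Computable cap ∧
      ∀ (n w : ℕ) (c₁ c₂ : SOFA.AutCode), c₁.IsSOFA n w →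
        (cap (n, w, c₁, c₂)).IsSOFA n (W w) ∧
        (cap (n, w, c₁, c₂)).secondLang n (W w) = c₁.secondLang n w ∩ c₂.secondLang n w) ∧
    (∃ cup : ℕ × ℕ × SOFA.AutCode × SOFA.AutCode → SOFA.AutCode, Computable cup ∧
      ∀ (n w : ℕ) (c₁ c₂ : SOFA.AutCode), c₁.IsSOFA n w → c₂.IsSOFA n w →
        (cup (n, w, c₁, c₂)).IsSOFA n (W w) ∧
        (cup (n, w, c₁, c₂)).secondLang n (W w) = c₁.secondLang n w ∪ c₂.secondLang n w) ∧
    (∃ diff : ℕ × ℕ × SOFA.AutCode × SOFA.AutCode → SOFA.AutCode, Computable diff ∧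
      ∀ (n w : ℕ) (c₁ c₂ : SOFA.AutCode), c₁.IsSOFA n w →
        (diff (n, w, c₁, c₂)).IsSOFA n (W w) ∧
        (diff (n, w, c₁, c₂)).secondLang n (W w) = c₁.secondLang n w \ c₂.secondLang n w) ∧
    (∃ det : ℕ × ℕ → SOFA.AutCode, Computable det ∧
      ∀ n w : ℕ,
        (det (n, w)).IsSOFA n w ∧ (det (n, w)).secondLang n w = SOFA.detLangs (Fin n) w) ∧
    (∃ compl : ℕ × ℕ × ℕ × SOFA.AutCode → SOFA.AutCode, Computable compl ∧
      ∀ (n w w' : ℕ) (c : SOFA.AutCode),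
        (compl (n, w, w', c)).IsSOFA n (W (max w w')) ∧
        (compl (n, w, w', c)).secondLang n (W (max w w')) =
          SOFA.widthCompl w' (c.secondLang n w)) ∧
    (∃ disj : ℕ × ℕ × SOFA.AutCode × SOFA.AutCode → Bool, Computable disj ∧
      ∀ (n w : ℕ) (c₁ c₂ : SOFA.AutCode),
        (disj (n, w, c₁, c₂) = true ↔ c₁.secondLang n w ∩ c₂.secondLang n w = ∅)) ∧
    (∃ incl : ℕ × ℕ × SOFA.AutCode × SOFA.AutCode → Bool, Computable incl ∧
      ∀ (n w : ℕ) (c₁ c₂ : SOFA.AutCode),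
        (incl (n, w, c₁, c₂) = true ↔ c₁.secondLang n w ⊆ c₂.secondLang n w)) := by
  have reg₁ {V : ℕ → ℕ} (hV : Primrec V) := SOFA.effectivelyRegularClass_secondLang_fst hV
  have reg₂ {V : ℕ → ℕ} (hV : Primrec V) := SOFA.effectivelyRegularClass_secondLang_snd hV
  refine ⟨fun A w σ σ₁ σ₂ _ _ _ F F₁ F₂ h₁ h₂ => ?_, ?_, ?_, ?_, ?_, ?_, ?_, ?_⟩
  · exact ⟨h₁.exists_inter (hle w), h₁.exists_union h₂ (hle w), h₁.exists_diff (hle w),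
      SOFA.exists_secondLang_eq_detLangs A w,
      fun w' => SOFA.exists_secondLang_eq_widthCompl F ((le_max_right w w').trans (hle _))⟩
  · obtain ⟨f, hf, h⟩ := ((reg₁ hW).inter (reg₂ hW)).exists_computable_secondLang_eq .fst
      (by fun_prop)
    exact ⟨f, hf, fun n w c₁ c₂ h₁ => h (n, w, c₁, c₂)
      (Set.inter_subset_left.trans (h₁.secondLang_subset_of_le (hle w)))⟩
  · obtain ⟨f, hf, h⟩ := ((reg₁ hW).union (reg₂ hW)).exists_computable_secondLang_eq .fst
      (by fun_prop)
    exact ⟨f, hf, fun n w c₁ c₂ h₁ h₂ => h (n, w, c₁, c₂) (Set.union_subset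
      (h₁.secondLang_subset_of_le (hle w)) (h₂.secondLang_subset_of_le (hle w)))⟩
  · obtain ⟨f, hf, h⟩ := ((reg₁ hW).diff (reg₂ hW)).exists_computable_secondLang_eq .fst
      (by fun_prop)
    exact ⟨f, hf, fun n w c₁ c₂ h₁ => h (n, w, c₁, c₂)
      (Set.sdiff_subset.trans (h₁.secondLang_subset_of_le (hle w)))⟩
  · obtain ⟨f, hf, h⟩ := (SOFA.effectivelyRegularClass_detLangs (α := ℕ × ℕ) .fst .snd
      .snd).exists_computable_secondLang_eq .fst .snd
    exact ⟨f, hf, fun n w => h (n, w) SOFA.detLangs_subset⟩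
  · obtain ⟨f, hf, h⟩ := (SOFA.effectivelyRegularClass_widthCompl
      hW).exists_computable_secondLang_eq .fst (by fun_prop)
    exact ⟨f, hf, fun n w w' c => h (n, w, w', c)
      (SOFA.widthCompl_subset _ ((le_max_right w w').trans (hle _)))⟩
  · obtain ⟨f, hf, h⟩ := ((reg₁ .id).inter (reg₂ .id)).exists_computable_isEmpty .fst (by fun_prop)
    exact ⟨f, hf, fun n w c₁ c₂ => h (n, w, c₁, c₂)
      (Set.inter_subset_left.trans (c₁.secondLang_subset_range_oddLang n w))⟩
  · obtain ⟨f, hf, h⟩ := ((reg₁ .id).diff (reg₂ .id)).exists_computable_isEmpty .fst (by fun_prop)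
    exact ⟨f, hf, fun n w c₁ c₂ => (h (n, w, c₁, c₂)
      (Set.sdiff_subset.trans (c₁.secondLang_subset_range_oddLang n w))).trans Set.sdiff_eq_empty⟩

theorem theorem4p1 :
    -- closure, over an arbitrary finite non-empty alphabet
    (∀ (A : Type*) [Finite A] [Nonempty A] (w : ℕ), 0 < w →
      ∀ (σ σ₁ σ₂ : Type*) [Finite σ] [Finite σ₁] [Finite σ₂]
        (F : NFA (SOFA.Layer A w) σ) (F₁ : NFA (SOFA.Layer A w) σ₁)
        (F₂ : NFA (SOFA.Layer A w) σ₂),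
        SOFA.IsSOFA F → SOFA.IsSOFA F₁ → SOFA.IsSOFA F₂ →
        (∃ (m : ℕ) (G : NFA (SOFA.Layer A (2 ^ w)) (Fin m)), SOFA.IsSOFA G ∧
          SOFA.secondLang G = SOFA.secondLang F₁ ∩ SOFA.secondLang F₂) ∧
        (∃ (m : ℕ) (G : NFA (SOFA.Layer A (2 ^ w)) (Fin m)), SOFA.IsSOFA G ∧
          SOFA.secondLang G = SOFA.secondLang F₁ ∪ SOFA.secondLang F₂) ∧
        (∃ (m : ℕ) (G : NFA (SOFA.Layer A (2 ^ w)) (Fin m)), SOFA.IsSOFA G ∧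
          SOFA.secondLang G = SOFA.secondLang F₁ \ SOFA.secondLang F₂) ∧
        (∃ (m : ℕ) (G : NFA (SOFA.Layer A w) (Fin m)), SOFA.IsSOFA G ∧
          SOFA.secondLang G = SOFA.detLangs A w) ∧
        (∀ w' : ℕ, 0 < w' →
          ∃ (m : ℕ) (G : NFA (SOFA.Layer A (2 ^ max w w')) (Fin m)), SOFA.IsSOFA G ∧
            SOFA.secondLang G = SOFA.widthCompl w' (SOFA.secondLang F))) ∧
    -- the automata can be computed, uniformly in the alphabet, the widths and the given automata
    (∃ cap : ℕ × ℕ × SOFA.AutCode × SOFA.AutCode → SOFA.AutCode, Computable cap ∧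
      ∀ n w : ℕ, 0 < n → 0 < w → ∀ c₁ c₂ : SOFA.AutCode, c₁.IsSOFA n w → c₂.IsSOFA n w →
        (cap (n, w, c₁, c₂)).IsSOFA n (2 ^ w) ∧
        (cap (n, w, c₁, c₂)).secondLang n (2 ^ w) = c₁.secondLang n w ∩ c₂.secondLang n w) ∧
    (∃ cup : ℕ × ℕ × SOFA.AutCode × SOFA.AutCode → SOFA.AutCode, Computable cup ∧
      ∀ n w : ℕ, 0 < n → 0 < w → ∀ c₁ c₂ : SOFA.AutCode, c₁.IsSOFA n w → c₂.IsSOFA n w →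
        (cup (n, w, c₁, c₂)).IsSOFA n (2 ^ w) ∧
        (cup (n, w, c₁, c₂)).secondLang n (2 ^ w) = c₁.secondLang n w ∪ c₂.secondLang n w) ∧
    (∃ diff : ℕ × ℕ × SOFA.AutCode × SOFA.AutCode → SOFA.AutCode, Computable diff ∧
      ∀ n w : ℕ, 0 < n → 0 < w → ∀ c₁ c₂ : SOFA.AutCode, c₁.IsSOFA n w → c₂.IsSOFA n w →
        (diff (n, w, c₁, c₂)).IsSOFA n (2 ^ w) ∧
        (diff (n, w, c₁, c₂)).secondLang n (2 ^ w) = c₁.secondLang n w \ c₂.secondLang n w) ∧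
    (∃ det : ℕ × ℕ → SOFA.AutCode, Computable det ∧
      ∀ n w : ℕ, 0 < n → 0 < w →
        (det (n, w)).IsSOFA n w ∧ (det (n, w)).secondLang n w = SOFA.detLangs (Fin n) w) ∧
    (∃ compl : ℕ × ℕ × ℕ × SOFA.AutCode → SOFA.AutCode, Computable compl ∧
      ∀ n w w' : ℕ, 0 < n → 0 < w → 0 < w' → ∀ c : SOFA.AutCode, c.IsSOFA n w →
        (compl (n, w, w', c)).IsSOFA n (2 ^ max w w') ∧
        (compl (n, w, w', c)).secondLang n (2 ^ max w w') =
          SOFA.widthCompl w' (c.secondLang n w)) ∧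
    -- decidability of disjointness and of inclusion
    (∃ disj : ℕ × ℕ × SOFA.AutCode × SOFA.AutCode → Bool, Computable disj ∧
      ∀ n w : ℕ, 0 < n → 0 < w → ∀ c₁ c₂ : SOFA.AutCode, c₁.IsSOFA n w → c₂.IsSOFA n w →
        (disj (n, w, c₁, c₂) = true ↔ c₁.secondLang n w ∩ c₂.secondLang n w = ∅)) ∧
    (∃ incl : ℕ × ℕ × SOFA.AutCode × SOFA.AutCode → Bool, Computable incl ∧
      ∀ n w : ℕ, 0 < n → 0 < w → ∀ c₁ c₂ : SOFA.AutCode, c₁.IsSOFA n w → c₂.IsSOFA n w →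
        (incl (n, w, c₁, c₂) = true ↔ c₁.secondLang n w ⊆ c₂.secondLang n w)) := by
  obtain ⟨closure, ⟨cap, hcap, h_cap⟩, ⟨cup, hcup, h_cup⟩, ⟨diff, hdiff, h_diff⟩,
    ⟨det, hdet, h_det⟩, ⟨compl, hcompl, h_compl⟩, ⟨disj, hdisj, h_disj⟩, incl, hincl, h_incl⟩ :=
    theorem4p1_general (2 ^ ·) (SOFA.primrec_pow (.const 2) .id) fun w => Nat.lt_two_pow_self.le
  refine ⟨fun A _ _ w _ σ σ₁ σ₂ _ _ _ F F₁ F₂ _ h₁ h₂ => ?_,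
    ⟨cap, hcap, fun n w _ _ c₁ c₂ h₁ _ => h_cap n w c₁ c₂ h₁⟩,
    ⟨cup, hcup, fun n w _ _ => h_cup n w⟩,
    ⟨diff, hdiff, fun n w _ _ c₁ c₂ h₁ _ => h_diff n w c₁ c₂ h₁⟩,
    ⟨det, hdet, fun n w _ _ => h_det n w⟩,
    ⟨compl, hcompl, fun n w w' _ _ _ c _ => h_compl n w w' c⟩,
    ⟨disj, hdisj, fun n w _ _ c₁ c₂ _ _ => h_disj n w c₁ c₂⟩,
    ⟨incl, hincl, fun n w _ _ c₁ c₂ _ _ => h_incl n w c₁ c₂⟩⟩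
  obtain ⟨h_inter, h_union, h_diff, h_det, h_compl⟩ := closure A w σ σ₁ σ₂ F F₁ F₂ h₁ h₂
  exact ⟨h_inter, h_union, h_diff, h_det, fun w' _ => h_compl w'⟩
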